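/- Let $r,r'\ge 0$ be integers and write $\mathbb S_r^+$ for the real symmetric positive semi-definite $r\times r$ matrices, $\le$ for the Loewner order, $M'$ for the transpose and $\|\cdot\|_2$ for the spectral norm. Let $A,R$ be real $r\times r$ matrices, $C$ a real $r'\times r$ matrix and $\Sigma$ a real $r'\times r'$ matrix, with $R$ and $\Sigma$ symmetric positive definite, and put $S:=C'\Sigma^{-1}C$ and $$\mathrm{Ricc}(Q):=AQ+QA'-QSQ+R .$$ For a triplet $(A,R,S)$ define the Gramians $$\mathcal O_t=\int_0^t e^{-A's}Se^{-As}\,ds,\qquad \mathcal C_t(\mathcal O)=\mathcal O_t^{-1}\Big[\int_0^t e^{-(t-s)A'}\mathcal O_sR\,\mathcal O_se^{-(t-s)A}\,ds\Big]\mathcal O_t^{-1},$$ $$\mathcal C_t=\int_0^t e^{As}Re^{A's}\,ds,\qquad \mathcal O_t(\mathcal C)=\mathcal C_t^{-1}\Big[\int_0^t e^{(t-s)A}\mathcal C_sS\,\mathcal C_se^{(t-s)A'}\,ds\Big]\mathcal C_t^{-1}.$$ The triplet satisfies the Gramian condition with parameter $v>0$ if $\varpi^c_-\mathrm{Id}\le\mathcal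 C_v\le\varpi^c_+\mathrm{Id}$ and $\varpi^o_-\mathrm{Id}\le\mathcal O_v\le\varpi^o_+\mathrm{Id}$ for some constants $\varpi^{c}_\pm,\varpi^{o}_\pm>0$. Assume that $(A,R,S)$ satisfies it with parameter $v$. Let $\pi:\mathbb S_r^+\to\mathbb S_r^+$ be a mapping and put $$\mathrm{Ricc}^\pi(Q):=[A-\pi(Q)S]Q+Q[A-\pi(Q)S]'+R+\pi(Q)S\pi(Q),\qquad \Gamma_\pi(Q):=\mathrm{Ricc}^\pi(Q)-\mathrm{Ricc}(Q).$$ $(H)_0$: there are symmetric matrices $B_0,B_2$ with $B_2\le S$, a matrix $B_1$, and a symmetric-matrix-valued map $\mathcal R$ on $\mathbb S_r^+$ with $\varpi:=\sup_{Q\in\mathbb S_r^+}\|\mathcal R(Q)\|_2<\infty$, such that for all $Q\in\mathbb S_r^+$ $$\Gamma_\pi(Q)=B_0+B_1Q+QB_1'+QB_2Q+\mathcal R(Q).$$ Put $A_\pi:=A+B_1$, $R_\pi:=R+B_0+\varpi\,\mathrm{Id}$, $S_\pi:=S-B_2$, and $\mathrm{Ricc}_\pi(Q):=A_\pi Q+QA_\pi'-QS_\pi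 Q+R_\pi$. Write $\mathcal O_{\pi,t}$ and $\mathcal C_{\pi,t}(\mathcal O)$ for the Gramians of $(A_\pi,R_\pi,S_\pi)$. $(H)_1$: $(A_\pi,R_\pi,S_\pi)$ satisfies the Gramian condition with some parameter $\nu_\pi>0$. Assume $(H)_0$ and $(H)_1$. Then: 1. The equations $\partial_tP_t=\mathrm{Ricc}(P_t)$ and $\partial_tP_t=\mathrm{Ricc}_\pi(P_t)$ have, from every $P_0=Q\in\mathbb S_r^+$, a unique $\mathbb S_r^+$-valued solution on $[0,\infty)$; denote these by $\phi_t(Q)$ and $\phi_{\pi,t}(Q)$. 2. For every $t\ge v\vee\nu_\pi$, every $Q\in\mathbb S_r^+$ and every $\mathbb S_r^+$-valued solution $s\mapsto\phi^\pi_s(Q)$ on $[0,t]$ of $\partial_sP_s=\mathrm{Ricc}^\pi(P_s)$, $P_0=Q$, $$(\mathcal O_v(\mathcal C)+\mathcal C_v^{-1})^{-1}\le\phi_t(Q)\le\phi^\pi_t(Q)\le\phi_{\pi,t}(Q)\le\mathcal O_{\pi,\nu_\pi}^{-1}+\mathcal C_{\pi,\nu_\pi}(\mathcal O).$$ 3.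 If $\mathrm{Ricc}^\pi$ is locally Lipschitz on $\mathbb S_r^+$, then $\partial_tP_t=\mathrm{Ricc}^\pi(P_t)$ has, from every $P_0=Q\in\mathbb S_r^+$, a unique $\mathbb S_r^+$-valued solution on $[0,\infty)$, so that the flow $\phi^\pi_t(Q)$ exists for all $t\ge0$. -/

import Mathlib

open scoped Matrix.Norms.L2Operator MatrixOrder

noncomputable section

/-- The matrix `S = C' Σ⁻¹ C` of a filtering problem with sensor matrix `C` and observation noise
covariance `Σ`. -/
def obsMatrix {r r' : ℕ} (C : Matrix (Fin r') (Fin r) ℝ) (Sig : Matrix (Fin r') (Fin r') ℝ) :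
    Matrix (Fin r) (Fin r) ℝ :=
  C.transpose * Sig⁻¹ * C

/-- The Riccati drift `Ricc(Q) = A Q + Q A' - Q S Q + R`. -/
def ricc {r : ℕ} (A R S Q : Matrix (Fin r) (Fin r) ℝ) : Matrix (Fin r) (Fin r) ℝ :=
  A * Q + Q * A.transpose - Q * S * Q + R

/-- The Riccati drift perturbed by a mapping `π`,
`Ricc^π(Q) = [A - π(Q) S] Q + Q [A - π(Q) S]' + R + π(Q) S π(Q)`. -/
def riccPert {r : ℕ} (A R S : Matrix (Fin r) (Fin r) ℝ)
    (π : Matrix (Fin r) (Fin r) ℝ → Matrix (Fin r) (Fin r) ℝ) (Q : Matrix (Fin r) (Fin r) ℝ) :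
    Matrix (Fin r) (Fin r) ℝ :=
  (A - π Q * S) * Q + Q * (A - π Q * S).transpose + R + π Q * S * π Q

/-- The observability Gramian `𝒪_t = ∫₀ᵗ e^{-A's} S e^{-As} ds`. -/
def obsGramian {r : ℕ} (A S : Matrix (Fin r) (Fin r) ℝ) (t : ℝ) : Matrix (Fin r) (Fin r) ℝ :=
  ∫ s in (0 : ℝ)..t, NormedSpace.exp (-(s • A.transpose)) * S * NormedSpace.exp (-(s • A))

/-- The controllability Gramian `𝒞_t = ∫₀ᵗ e^{As} R e^{A's} ds`. -/
def ctrlGramian {r : ℕ} (A R : Matrix (Fin r) (Fin r) ℝ) (t : ℝ) : Matrix (Fin r) (Fin r) ℝ :=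
  ∫ s in (0 : ℝ)..t, NormedSpace.exp (s • A) * R * NormedSpace.exp (s • A.transpose)

/-- `𝒞_t(𝒪) = 𝒪_t⁻¹ [∫₀ᵗ e^{-(t-s)A'} 𝒪_s R 𝒪_s e^{-(t-s)A} ds] 𝒪_t⁻¹`. -/
def ctrlObsGramian {r : ℕ} (A R S : Matrix (Fin r) (Fin r) ℝ) (t : ℝ) :
    Matrix (Fin r) (Fin r) ℝ :=
  (obsGramian A S t)⁻¹ *
    (∫ s in (0 : ℝ)..t, NormedSpace.exp (-((t - s) • A.transpose)) * obsGramian A S s * R *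
      obsGramian A S s * NormedSpace.exp (-((t - s) • A))) *
    (obsGramian A S t)⁻¹

/-- `𝒪_t(𝒞) = 𝒞_t⁻¹ [∫₀ᵗ e^{(t-s)A} 𝒞_s S 𝒞_s e^{(t-s)A'} ds] 𝒞_t⁻¹`. -/
def obsCtrlGramian {r : ℕ} (A R S : Matrix (Fin r) (Fin r) ℝ) (t : ℝ) :
    Matrix (Fin r) (Fin r) ℝ :=
  (ctrlGramian A R t)⁻¹ *
    (∫ s in (0 : ℝ)..t, NormedSpace.exp ((t - s) • A) * ctrlGramian A R s * S *
      ctrlGramian A R s * NormedSpace.exp ((t - s) • A.transpose)) *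
    (ctrlGramian A R t)⁻¹

/-- The Gramian condition for the triplet `(A, R, S)` with interval of
observability-controllability `v > 0`, in the Loewner order:
`ϖ₋ᶜ Id ≤ 𝒞_v ≤ ϖ₊ᶜ Id` and `ϖ₋ᵒ Id ≤ 𝒪_v ≤ ϖ₊ᵒ Id` for some positive constants. -/
def GramianCondition {r : ℕ} (A R S : Matrix (Fin r) (Fin r) ℝ) (v : ℝ) : Prop :=
  0 < v ∧
    (∃ a b : ℝ, 0 < a ∧ 0 < b ∧
      a • (1 : Matrix (Fin r) (Fin r) ℝ) ≤ ctrlGramian A R v ∧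
      ctrlGramian A R v ≤ b • (1 : Matrix (Fin r) (Fin r) ℝ)) ∧
    (∃ a b : ℝ, 0 < a ∧ 0 < b ∧
      a • (1 : Matrix (Fin r) (Fin r) ℝ) ≤ obsGramian A S v ∧
      obsGramian A S v ≤ b • (1 : Matrix (Fin r) (Fin r) ℝ))

/-- The quadratic perturbation hypothesis: on positive semi-definite `Q`,
`Γ_π(Q) := Ricc^π(Q) - Ricc(Q)` equals `B₀ + B₁ Q + Q B₁' + Q B₂ Q + ℛ(Q)`, with `B₀, B₂`
symmetric, `B₁` arbitrary (symmetry of `B₁` is not needed), `B₂ ≤ S`, and a symmetric remainder `ℛ` that is bounded in the spectral norm. -/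
structure QuadraticPerturbation {r : ℕ} (A R S : Matrix (Fin r) (Fin r) ℝ)
    (π : Matrix (Fin r) (Fin r) ℝ → Matrix (Fin r) (Fin r) ℝ)
    (B₀ B₁ B₂ : Matrix (Fin r) (Fin r) ℝ)
    (Rem : Matrix (Fin r) (Fin r) ℝ → Matrix (Fin r) (Fin r) ℝ) : Prop where
  symm₀ : B₀.IsSymm
  symm₂ : B₂.IsSymm
  le : B₂ ≤ S
  rem_symm : ∀ Q : Matrix (Fin r) (Fin r) ℝ, Q.PosSemidef → (Rem Q).IsSymm
  rem_bdd : BddAbove ((fun Q => ‖Rem Q‖) '' {Q : Matrix (Fin r) (Fin r) ℝ | Q.PosSemidef})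
  eq : ∀ Q : Matrix (Fin r) (Fin r) ℝ, Q.PosSemidef →
    riccPert A R S π Q - ricc A R S Q =
      B₀ + B₁ * Q + Q * B₁.transpose + Q * B₂ * Q + Rem Q

/-- `ϖ = sup {‖ℛ(Q)‖₂ : Q positive semi-definite}`. -/
def remBound {r : ℕ} (Rem : Matrix (Fin r) (Fin r) ℝ → Matrix (Fin r) (Fin r) ℝ) : ℝ :=
  sSup ((fun Q => ‖Rem Q‖) '' {Q : Matrix (Fin r) (Fin r) ℝ | Q.PosSemidef})

/-- `P` solves `∂ₜ P_t = F(P_t)`, `P_0 = Q` on the time interval `[0, T]`, within the positive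
semi-definite matrices (the domain of the drift `F`). -/
def IsSolution {r : ℕ} (F : Matrix (Fin r) (Fin r) ℝ → Matrix (Fin r) (Fin r) ℝ)
    (Q : Matrix (Fin r) (Fin r) ℝ) (T : ℝ) (P : ℝ → Matrix (Fin r) (Fin r) ℝ) : Prop :=
  P 0 = Q ∧ ∀ s ∈ Set.Icc (0 : ℝ) T,
    (P s).PosSemidef ∧ HasDerivWithinAt P (F (P s)) (Set.Icc (0 : ℝ) T) s

/-- `φ` is the (global) flow of the drift `F` on the positive semi-definite matrices:
`t ↦ φ_t(Q)` is a solution started at `Q` on every `[0, T]`, and the only one. -/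
def IsFlow {r : ℕ} (F : Matrix (Fin r) (Fin r) ℝ → Matrix (Fin r) (Fin r) ℝ)
    (φ : ℝ → Matrix (Fin r) (Fin r) ℝ → Matrix (Fin r) (Fin r) ℝ) : Prop :=
  ∀ Q : Matrix (Fin r) (Fin r) ℝ, Q.PosSemidef → ∀ T : ℝ, 0 ≤ T →
    IsSolution F Q T (fun t => φ t Q) ∧
      ∀ P : ℝ → Matrix (Fin r) (Fin r) ℝ, IsSolution F Q T P →
        Set.EqOn P (fun t => φ t Q) (Set.Icc (0 : ℝ) T)

end

/-! The ordering rests on two pointwise drift inequalities on the cone. Completing the square gives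
`Γ_π(Q) = (π(Q) - Q)' S (π(Q) - Q) ≥ 0`, while the quadratic form of `Γ_π` with `ℛ(Q) ≤ ϖ Id` gives
`Ricc^π ≤ Ricc_π`. A comparison principle (`riccati_comparison`) turns `Ricc ≤ Ricc^π ≤ Ricc_π` into
the order of the solutions.

The outer bounds do not depend on the initial condition, so by autonomy they are needed only on a
window of length `v` or `ν_π` ending at `t`. The upper one (`le_gramian_of_subsolution`) tests the
equation along a matrix path `Λ` steered from `0` to `Id`: the start of the window is multiplied by
`0`, and a completed square leaves the cost of steering, which is the Gramian expression. The lower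
one (`gramian_le_of_solution`) is the upper one for the inverse, whose Riccati equation has triplet
`(-A', S, R)`.

Global flows come from `IsInwardDrift`: extend the drift to all matrices as a bounded Lipschitz
field, solve, then show that the solution never leaves the region where nothing was changed.
Invariance of the cone and the comparison principle both follow from the barrier lemma
`posDef_of_barrier`. -/

section RiccatiFlows

open Matrix Set Filter Topology

variable {r : ℕ}

/-! ### Real quadratic forms and the Loewner order. -/

theorem isHermitian_iff_isSymm_real {M : Matrix (Fin r) (Fin r) ℝ} : M.IsHermitian ↔ M.IsSymm := by
  rw [Matrix.IsHermitian, Matrix.IsSymm, conjTranspose_eq_transpose_of_trivial]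

theorem posSemidef_iff_quadratic {M : Matrix (Fin r) (Fin r) ℝ} :
    M.PosSemidef ↔ M.IsSymm ∧ ∀ x : Fin r → ℝ, 0 ≤ x ⬝ᵥ (M *ᵥ x) := by
  rw [posSemidef_iff_dotProduct_mulVec, isHermitian_iff_isSymm_real]
  simp

theorem posDef_iff_quadratic {M : Matrix (Fin r) (Fin r) ℝ} :
    M.PosDef ↔ M.IsSymm ∧ ∀ x : Fin r → ℝ, x ≠ 0 → 0 < x ⬝ᵥ (M *ᵥ x) := by
  rw [posDef_iff_dotProduct_mulVec, isHermitian_iff_isSymm_real]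
  simp

theorem le_iff_quadratic {M N : Matrix (Fin r) (Fin r) ℝ} (hM : M.IsSymm) (hN : N.IsSymm) :
    M ≤ N ↔ ∀ x : Fin r → ℝ, x ⬝ᵥ (M *ᵥ x) ≤ x ⬝ᵥ (N *ᵥ x) := by
  rw [Matrix.le_iff, posSemidef_iff_quadratic]
  simp [hN.sub hM, sub_mulVec, dotProduct_sub]

theorem Matrix.PosSemidef.isSymm {M : Matrix (Fin r) (Fin r) ℝ} (h : M.PosSemidef) : M.IsSymm :=
  (posSemidef_iff_quadratic.1 h).1

theorem Matrix.PosSemidef.quadratic_nonneg {M : Matrix (Fin r) (Fin r) ℝ} (h : M.PosSemidef)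
    (x : Fin r → ℝ) : 0 ≤ x ⬝ᵥ (M *ᵥ x) :=
  (posSemidef_iff_quadratic.1 h).2 x

theorem Matrix.PosSemidef.transpose_mul_mul {M : Matrix (Fin r) (Fin r) ℝ} (h : M.PosSemidef)
    (B : Matrix (Fin r) (Fin r) ℝ) : (Bᵀ * M * B).PosSemidef := by
  simpa [conjTranspose_eq_transpose_of_trivial] using h.conjTranspose_mul_mul_same B

theorem Matrix.PosSemidef.mulVec_eq_zero {M : Matrix (Fin r) (Fin r) ℝ} (h : M.PosSemidef)
    {x : Fin r → ℝ} (hx : x ⬝ᵥ (M *ᵥ x) = 0) : M *ᵥ x = 0 :=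
  (h.dotProduct_mulVec_zero_iff x).1 (by simpa using hx)

theorem Matrix.IsSymm.dotProduct_mulVec_comm {M : Matrix (Fin r) (Fin r) ℝ} (h : M.IsSymm)
    (x y : Fin r → ℝ) : x ⬝ᵥ (M *ᵥ y) = (M *ᵥ x) ⬝ᵥ y := by
  rw [dotProduct_mulVec, ← mulVec_transpose, h.eq]

theorem dotProduct_mulVec_transpose (M : Matrix (Fin r) (Fin r) ℝ) (x y : Fin r → ℝ) :
    x ⬝ᵥ (Mᵀ *ᵥ y) = y ⬝ᵥ (M *ᵥ x) := by
  rw [mulVec_transpose, dotProduct_comm, dotProduct_mulVec]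

theorem abs_dotProduct_mulVec_le (M : Matrix (Fin r) (Fin r) ℝ) (x : Fin r → ℝ) :
    |x ⬝ᵥ (M *ᵥ x)| ≤ ‖M‖ * (x ⬝ᵥ x) := by
  have h1 := l2_opNorm_mulVec M (WithLp.toLp 2 x)
  have h2 := abs_real_inner_le_norm (WithLp.toLp 2 x) (WithLp.toLp 2 (M *ᵥ x))
  have h3 : inner ℝ (WithLp.toLp 2 x) (WithLp.toLp 2 (M *ᵥ x)) = x ⬝ᵥ (M *ᵥ x) := by
    rw [EuclideanSpace.inner_toLp_toLp]; simp [dotProduct_comm]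
  have h4 : x ⬝ᵥ x = ‖WithLp.toLp 2 x‖ ^ 2 := by
    rw [← real_inner_self_eq_norm_sq, EuclideanSpace.inner_toLp_toLp]; simp
  rw [h3] at h2
  refine h2.trans ?_
  rw [h4]
  have := mul_le_mul_of_nonneg_left h1 (norm_nonneg (WithLp.toLp 2 x))
  calc _ ≤ _ := this
    _ = _ := by simp only []; ring

theorem isSymm_smul_one (c : ℝ) : (c • (1 : Matrix (Fin r) (Fin r) ℝ)).IsSymm := by
  simp [Matrix.IsSymm]

theorem le_norm_smul_one {M : Matrix (Fin r) (Fin r) ℝ} (h : M.IsSymm) :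
    M ≤ ‖M‖ • (1 : Matrix (Fin r) (Fin r) ℝ) := by
  rw [le_iff_quadratic h (isSymm_smul_one _)]
  intro x
  simpa [smul_mulVec] using (le_abs_self _).trans (abs_dotProduct_mulVec_le M x)

/-- Evaluation of the quadratic form at a fixed vector, as a continuous linear map in the matrix. -/
noncomputable def quadEval (x y : Fin r → ℝ) : Matrix (Fin r) (Fin r) ℝ →L[ℝ] ℝ :=
  LinearMap.toContinuousLinearMap
    { toFun := fun M => x ⬝ᵥ (M *ᵥ y)
      map_add' := fun M N => by simp [add_mulVec]
      map_smul' := fun c M => by simp [smul_mulVec] }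

@[simp] theorem quadEval_apply (x y : Fin r → ℝ) (M : Matrix (Fin r) (Fin r) ℝ) :
    quadEval x y M = x ⬝ᵥ (M *ᵥ y) := rfl

/-- Transposition as a continuous linear map. -/
noncomputable def transposeL : Matrix (Fin r) (Fin r) ℝ →L[ℝ] Matrix (Fin r) (Fin r) ℝ :=
  LinearMap.toContinuousLinearMap (Matrix.transposeLinearEquiv (Fin r) (Fin r) ℝ ℝ).toLinearMap

@[simp] theorem transposeL_apply (M : Matrix (Fin r) (Fin r) ℝ) : transposeL M = Mᵀ := rfl

/-- The trace as a continuous linear map. -/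
noncomputable def traceL : Matrix (Fin r) (Fin r) ℝ →L[ℝ] ℝ :=
  LinearMap.toContinuousLinearMap (Matrix.traceLinearMap (Fin r) ℝ ℝ)

@[simp] theorem traceL_apply (M : Matrix (Fin r) (Fin r) ℝ) : traceL M = M.trace := rfl

theorem isClosed_posSemidef : IsClosed {M : Matrix (Fin r) (Fin r) ℝ | M.PosSemidef} := by
  have : {M : Matrix (Fin r) (Fin r) ℝ | M.PosSemidef} =
      {M | transposeL M = M} ∩ ⋂ x : Fin r → ℝ, {M | 0 ≤ quadEval x x M} := by
    ext M
    simp [posSemidef_iff_quadratic, Matrix.IsSymm]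
  rw [this]
  exact (isClosed_eq transposeL.continuous continuous_id).inter
    (isClosed_iInter fun x => isClosed_le continuous_const (quadEval x x).continuous)

/-! ### Entries, spectral norm and trace. -/

/-- Testing on `e_i ± e_j` gives `2 |Q i j| ≤ Q i i + Q j j`. Hence on the cone the trace, a linear
functional, controls the norm. -/
theorem abs_entry_le_trace {Q : Matrix (Fin r) (Fin r) ℝ} (hQ : Q.PosSemidef) (i j : Fin r) :
    |Q i j| ≤ Q.trace := by
  have hs := hQ.isSymm.apply i j
  have hi : ∀ k, Q k k ≤ Q.trace := fun k =>
    Finset.single_le_sum (f := fun k => Q k k) (fun l _ => hQ.diag_nonneg) (Finset.mem_univ k)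
  have h1 := hQ.quadratic_nonneg (Pi.single i 1 + Pi.single j 1)
  have h2 := hQ.quadratic_nonneg (Pi.single i 1 - Pi.single j 1)
  simp [mulVec_add, mulVec_sub, add_dotProduct, sub_dotProduct, dotProduct_add,
    dotProduct_sub] at h1 h2
  rw [abs_le]
  constructor <;> linarith [hi i, hi j]

theorem abs_entry_le_norm (M : Matrix (Fin r) (Fin r) ℝ) (i j : Fin r) : |M i j| ≤ ‖M‖ := by
  have h1 := l2_opNorm_mulVec M (EuclideanSpace.single j 1)
  have h2 := PiLp.norm_apply_le (WithLp.toLp 2 (M *ᵥ (EuclideanSpace.single j (1 : ℝ)).ofLp)) i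
  simp at h1 h2
  exact h2.trans h1

theorem norm_le_of_abs_entry_le : ∃ c : ℝ, 0 ≤ c ∧ ∀ (M : Matrix (Fin r) (Fin r) ℝ) (b : ℝ),
    (∀ i j, |M i j| ≤ b) → ‖M‖ ≤ c * b := by
  refine ⟨∑ i, ∑ j, ‖(single i j 1 : Matrix (Fin r) (Fin r) ℝ)‖, by positivity, fun M b h => ?_⟩
  conv_lhs => rw [matrix_eq_sum_single M]
  rw [Finset.sum_mul]
  refine norm_sum_le_of_le _ fun i _ => ?_
  rw [Finset.sum_mul]
  refine norm_sum_le_of_le _ fun j _ => ?_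
  have : (single i j (M i j) : Matrix (Fin r) (Fin r) ℝ) = M i j • single i j 1 := by simp
  rw [this, norm_smul, mul_comm]
  exact mul_le_mul_of_nonneg_left (h i j) (norm_nonneg _)

theorem norm_le_trace : ∃ c : ℝ, 0 ≤ c ∧ ∀ Q : Matrix (Fin r) (Fin r) ℝ, Q.PosSemidef →
    ‖Q‖ ≤ c * Q.trace := by
  obtain ⟨c, hc, h⟩ := norm_le_of_abs_entry_le (r := r)
  exact ⟨c, hc, fun Q hQ => h Q _ (abs_entry_le_trace hQ)⟩

theorem abs_trace_le (M : Matrix (Fin r) (Fin r) ℝ) : |M.trace| ≤ r * ‖M‖ := by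
  refine (Finset.abs_sum_le_sum_abs _ _).trans ?_
  refine (Finset.sum_le_card_nsmul _ _ ‖M‖ fun i _ => abs_entry_le_norm M i i).trans ?_
  simp

/-- With `Q = B* B`, cyclicity turns the trace into that of the congruence `B P B*`. -/
theorem trace_mul_nonneg {P Q : Matrix (Fin r) (Fin r) ℝ} (hP : P.PosSemidef)
    (hQ : Q.PosSemidef) : 0 ≤ (P * Q).trace := by
  obtain ⟨B, rfl⟩ := CStarAlgebra.nonneg_iff_eq_star_mul_self.1 (nonneg_iff_posSemidef.2 hQ)
  rw [← mul_assoc, trace_mul_comm, ← mul_assoc]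
  have := hP.mul_mul_conjTranspose_same B
  exact this.trace_nonneg

theorem trace_mul_self_eq {D : Matrix (Fin r) (Fin r) ℝ} (hD : D.IsSymm)
    (E : Matrix (Fin r) (Fin r) ℝ) :
    (D * E).trace = ∑ p : Fin r × Fin r, D p.1 p.2 * E p.1 p.2 := by
  rw [Fintype.sum_prod_type_right]
  simp only [Matrix.trace, Matrix.diag, Matrix.mul_apply]
  exact Finset.sum_congr rfl fun i _ => Finset.sum_congr rfl fun j _ => by rw [hD.apply]

/-! ### The positive part as a Lipschitz retraction onto the cone. -/

/-- The positive part of the symmetrization of a matrix. -/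
noncomputable def symmPosPart (X : Matrix (Fin r) (Fin r) ℝ) : Matrix (Fin r) (Fin r) ℝ :=
  ((1 / 2 : ℝ) • (X + Xᵀ))⁺

theorem posSemidef_posPart (X : Matrix (Fin r) (Fin r) ℝ) : (X⁺).PosSemidef :=
  nonneg_iff_posSemidef.1 (CFC.posPart_nonneg X)

theorem posSemidef_negPart (X : Matrix (Fin r) (Fin r) ℝ) : (X⁻).PosSemidef :=
  nonneg_iff_posSemidef.1 (CFC.negPart_nonneg X)

theorem symmPosPart_of_isSymm {X : Matrix (Fin r) (Fin r) ℝ} (h : X.IsSymm) :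
    symmPosPart X = X⁺ := by
  rw [symmPosPart, h.eq, ← two_smul ℝ X, smul_smul]
  norm_num

theorem symmPosPart_of_posSemidef {X : Matrix (Fin r) (Fin r) ℝ} (h : X.PosSemidef) :
    symmPosPart X = X := by
  rw [symmPosPart_of_isSymm h.isSymm, CFC.posPart_eq_self]
  exact nonneg_iff_posSemidef.2 h

/-- The positive part annihilates eigenvectors of a negative eigenvalue. -/
theorem posPart_mulVec_eq_zero {X : Matrix (Fin r) (Fin r) ℝ} (h : X.IsSymm) {c : ℝ} (hc : 0 < c)
    {x : Fin r → ℝ} (hx : X *ᵥ x = -(c • x)) : X⁺ *ᵥ x = 0 := by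
  have hsub := CFC.posPart_sub_negPart X (isHermitian_iff_isSymm_real.2 h)
  have hP := posSemidef_posPart X
  have h1 : X⁺ * X⁺ = X⁺ * X := by
    have := congrArg (X⁺ * ·) hsub
    simpa only [mul_sub, CFC.posPart_mul_negPart, sub_zero] using this
  apply hP.mulVec_eq_zero
  -- The square of the length of `X⁺ x` equals `-c` times a nonnegative form, so both vanish.
  have h2 : (X⁺ *ᵥ x) ⬝ᵥ (X⁺ *ᵥ x) = -(c * (x ⬝ᵥ (X⁺ *ᵥ x))) := by
    rw [← hP.isSymm.dotProduct_mulVec_comm, mulVec_mulVec, h1, ← mulVec_mulVec, hx]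
    simp [mulVec_neg, mulVec_smul]
  have h3 : 0 ≤ (X⁺ *ᵥ x) ⬝ᵥ (X⁺ *ᵥ x) := by
    simpa using dotProduct_star_self_nonneg (X⁺ *ᵥ x)
  have h4 := hP.quadratic_nonneg x
  nlinarith

/-- The positive part is the Frobenius projection onto a convex cone, hence a contraction: since `X⁺
X⁻ = 0`, the inner product of `X⁺ - Y⁺` with `X - Y` exceeds the square of the former by the cross
terms `tr (X⁺ Y⁻) + tr (Y⁺ X⁻) ≥ 0`, and Cauchy–Schwarz concludes. -/
theorem sum_sq_posPart_sub_le {X Y : Matrix (Fin r) (Fin r) ℝ} (hX : X.IsSymm) (hY : Y.IsSymm) :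
    ∑ p : Fin r × Fin r, (X⁺ - Y⁺) p.1 p.2 ^ 2 ≤ ∑ p : Fin r × Fin r, (X - Y) p.1 p.2 ^ 2 := by
  have hD : (X⁺ - Y⁺).IsSymm := (posSemidef_posPart X).isSymm.sub (posSemidef_posPart Y).isSymm
  have h1 : ((X⁺ - Y⁺) * (X⁺ - Y⁺)).trace ≤ ((X⁺ - Y⁺) * (X - Y)).trace := by
    have e : (X⁺ - Y⁺) * (X - Y) = (X⁺ - Y⁺) * (X⁺ - Y⁺) + X⁺ * Y⁻ + Y⁺ * X⁻ := by
      have eX := congrArg ((X⁺ - Y⁺) * ·) (CFC.posPart_sub_negPart X (isHermitian_iff_isSymm_real.2 hX))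
      have eY := congrArg ((X⁺ - Y⁺) * ·) (CFC.posPart_sub_negPart Y (isHermitian_iff_isSymm_real.2 hY))
      simp only [sub_mul, mul_sub, CFC.posPart_mul_negPart] at eX eY ⊢
      rw [← eX, ← eY]
      abel
    rw [e, trace_add, trace_add]
    linarith [trace_mul_nonneg (posSemidef_posPart X) (posSemidef_negPart Y),
      trace_mul_nonneg (posSemidef_posPart Y) (posSemidef_negPart X)]
  rw [trace_mul_self_eq hD, trace_mul_self_eq hD] at h1
  have h2 := Finset.sum_mul_sq_le_sq_mul_sq Finset.univ
    (fun p : Fin r × Fin r => (X⁺ - Y⁺) p.1 p.2) (fun p => (X - Y) p.1 p.2)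
  simp only [← pow_two] at h1
  have h3 : 0 ≤ ∑ p : Fin r × Fin r, (X⁺ - Y⁺) p.1 p.2 ^ 2 := by positivity
  by_contra! hlt
  have h5 : 0 ≤ ∑ p : Fin r × Fin r, (X - Y) p.1 p.2 ^ 2 := by positivity
  nlinarith

theorem exists_lipschitz_symmPosPart :
    ∃ K : NNReal, LipschitzWith K (symmPosPart (r := r)) := by
  obtain ⟨c, hc, h⟩ := norm_le_of_abs_entry_le (r := r)
  have hsym : ∀ X : Matrix (Fin r) (Fin r) ℝ, ((1 / 2 : ℝ) • (X + Xᵀ)).IsSymm := fun X => by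
    simp [Matrix.IsSymm, add_comm]
  refine ⟨⟨c * r, by positivity⟩, LipschitzWith.of_dist_le_mul fun X Y => ?_⟩
  rw [dist_eq_norm, dist_eq_norm]
  change _ ≤ c * r * _
  rw [mul_assoc]
  have hn : ‖(1 / 2 : ℝ) • (X + Xᵀ) - (1 / 2 : ℝ) • (Y + Yᵀ)‖ ≤ ‖X - Y‖ := by
    have e : (1 / 2 : ℝ) • (X + Xᵀ) - (1 / 2 : ℝ) • (Y + Yᵀ) =
        (1 / 2 : ℝ) • ((X - Y) + (X - Y)ᵀ) := by
      rw [transpose_sub, ← smul_sub]; congr 1; abel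
    rw [e, norm_smul]
    have := norm_add_le (X - Y) (X - Y)ᵀ
    have h2 := l2_opNorm_conjTranspose (X - Y)
    rw [conjTranspose_eq_transpose_of_trivial] at h2
    rw [h2] at this
    rw [Real.norm_of_nonneg (by norm_num)]
    linarith
  refine h _ _ fun i j => ?_
  have h1 := sum_sq_posPart_sub_le (hsym X) (hsym Y)
  refine abs_le_of_sq_le_sq ?_ (by positivity)
  have h3 := Finset.single_le_sum (f := fun p : Fin r × Fin r =>
    (symmPosPart X - symmPosPart Y) p.1 p.2 ^ 2) (fun _ _ => sq_nonneg _) (Finset.mem_univ (i, j))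
  refine h3.trans (h1.trans ?_)
  refine (Finset.sum_le_card_nsmul _ _ (‖X - Y‖ ^ 2) fun p _ => ?_).trans ?_
  · rw [← sq_abs]
    exact pow_le_pow_left₀ (abs_nonneg _) ((abs_entry_le_norm _ _ _).trans hn) 2
  · simp; ring_nf; rfl

/-! ### Barrier and monotonicity lemmas for matrix paths. -/

/-- A path of symmetric matrices that starts positive definite stays so, provided that its
derivative is positive on the kernel whenever the path meets the boundary of the cone. -/
theorem posDef_of_barrier {T : ℝ} {Y Y' : ℝ → Matrix (Fin r) (Fin r) ℝ}
    (hsymm : ∀ s ∈ Icc 0 T, (Y s).IsSymm)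
    (hY : ∀ s ∈ Icc 0 T, HasDerivWithinAt Y (Y' s) (Icc 0 T) s) (h0 : (Y 0).PosDef)
    (hb : ∀ s ∈ Icc 0 T, (Y s).PosSemidef → ∀ x : Fin r → ℝ, x ≠ 0 → Y s *ᵥ x = 0 →
      0 < x ⬝ᵥ (Y' s *ᵥ x)) :
    ∀ s ∈ Icc 0 T, (Y s).PosDef := by
  have hcont : ContinuousOn Y (Icc 0 T) := fun s hs => (hY s hs).continuousWithinAt
  let K : Set (ℝ × (Fin r → ℝ)) :=
    {p | p ∈ Icc 0 T ×ˢ Metric.sphere (0 : Fin r → ℝ) 1 ∧ p.2 ⬝ᵥ (Y p.1 *ᵥ p.2) ≤ 0}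
  have hc : ContinuousOn (fun p : ℝ × (Fin r → ℝ) => p.2 ⬝ᵥ (Y p.1 *ᵥ p.2))
      (Icc 0 T ×ˢ Metric.sphere (0 : Fin r → ℝ) 1) := by
    have h1 : ContinuousOn (fun p : ℝ × (Fin r → ℝ) => Y p.1)
        (Icc 0 T ×ˢ Metric.sphere (0 : Fin r → ℝ) 1) :=
      hcont.comp continuousOn_fst fun p hp => hp.1
    have h2 : Continuous fun q : Matrix (Fin r) (Fin r) ℝ × (Fin r → ℝ) => q.2 ⬝ᵥ (q.1 *ᵥ q.2) := by
      fun_prop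
    exact h2.comp_continuousOn (h1.prodMk continuousOn_snd)
  have hKc : IsCompact K := by
    have hcpt : IsCompact (Icc 0 T ×ˢ Metric.sphere (0 : Fin r → ℝ) 1) :=
      isCompact_Icc.prod (isCompact_sphere _ _)
    exact hcpt.of_isClosed_subset
      (hc.preimage_isClosed_of_isClosed hcpt.isClosed isClosed_Iic) fun p hp => hp.1
  have hnorm : ∀ x : Fin r → ℝ, x ≠ 0 → ∃ a : ℝ, 0 < a ∧ a • x ∈ Metric.sphere (0 : Fin r → ℝ) 1 :=
    fun x hx => ⟨‖x‖⁻¹, by positivity, by simp [norm_smul, norm_ne_zero_iff.2 hx]⟩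
  have hscale : ∀ (M : Matrix (Fin r) (Fin r) ℝ) (a : ℝ) (x : Fin r → ℝ),
      (a • x) ⬝ᵥ (M *ᵥ (a • x)) = a ^ 2 * (x ⬝ᵥ (M *ᵥ x)) := fun M a x => by
    simp [mulVec_smul]; ring
  have hKe : K = ∅ := by
    by_contra hne
    -- By compactness there is a first time `τ` at which some unit vector `x` has a nonpositive
    -- form.
    obtain ⟨⟨τ, x⟩, ⟨⟨hτ, hx⟩, hle⟩, hmin⟩ :=
      hKc.exists_isMinOn (nonempty_iff_ne_empty.2 hne) continuousOn_fst
    simp only at hτ hx hle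
    have hx0 : x ≠ 0 := by rintro rfl; simp at hx
    have hpos : ∀ s, 0 ≤ s → s < τ → ∀ y : Fin r → ℝ, y ≠ 0 → 0 < y ⬝ᵥ (Y s *ᵥ y) := by
      intro s hs hsτ y hy
      obtain ⟨a, ha, hay⟩ := hnorm y hy
      by_contra! hneg
      have hmem : (s, a • y) ∈ K := ⟨⟨⟨hs, hsτ.le.trans hτ.2⟩, hay⟩, by
        simp only [hscale]; nlinarith [sq_nonneg a]⟩
      have := hmin hmem
      simp only [mem_ofPred_eq] at this
      linarith
    have hτ0 : 0 < τ := by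
      rcases hτ.1.lt_or_eq with h | h
      · exact h
      · subst h
        exact absurd ((posDef_iff_quadratic.1 h0).2 x hx0) hle.not_gt
    have hd : ∀ y : Fin r → ℝ,
        HasDerivWithinAt (fun s => y ⬝ᵥ (Y s *ᵥ y)) (y ⬝ᵥ (Y' τ *ᵥ y)) (Iio τ) τ := by
      intro y
      have h1 := (quadEval y y).hasFDerivAt.comp_hasDerivWithinAt τ (hY τ hτ)
      exact (h1.mono (Icc_subset_Icc_right hτ.2)).mono_of_mem_nhdsWithin
        (mem_of_superset (Ioo_mem_nhdsLT hτ0) Ioo_subset_Icc_self)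
    have hev : ∀ y : Fin r → ℝ, y ≠ 0 → ∀ᶠ s in 𝓝[<] τ, 0 < y ⬝ᵥ (Y s *ᵥ y) := fun y hy => by
      filter_upwards [Ioo_mem_nhdsLT hτ0] with s hs using hpos s hs.1.le hs.2 y hy
    have hpsd : (Y τ).PosSemidef := by
      refine posSemidef_iff_quadratic.2 ⟨hsymm τ hτ, fun y => ?_⟩
      by_cases hy : y = 0
      · simp [hy]
      · exact ge_of_tendsto (hd y).continuousWithinAt ((hev y hy).mono fun s hs => hs.le)
    have hq : x ⬝ᵥ (Y τ *ᵥ x) = 0 := le_antisymm hle (hpsd.quadratic_nonneg x)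
    have hbx := hb τ hτ hpsd x hx0 (hpsd.mulVec_eq_zero hq)
    have hslope := hasDerivWithinAt_iff_tendsto_slope.1 (hd x)
    -- The form at `x` is positive before `τ` and zero at `τ`, so its left difference quotients are
    -- nonpositive, against `hb`.
    have hle' : x ⬝ᵥ (Y' τ *ᵥ x) ≤ 0 := by
      rw [sdiff_singleton_eq_self (by simp)] at hslope
      refine le_of_tendsto hslope ?_
      filter_upwards [hev x hx0, self_mem_nhdsWithin] with s hs hsτ
      rw [slope_def_field, hq]
      exact div_nonpos_of_nonneg_of_nonpos (by linarith) (by have := mem_Iio.1 hsτ; linarith)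
    linarith
  intro s hs
  refine posDef_iff_quadratic.2 ⟨hsymm s hs, fun y hy => ?_⟩
  obtain ⟨a, ha, hay⟩ := hnorm y hy
  by_contra! hneg
  have hmem : (s, a • y) ∈ K := ⟨⟨hs, hay⟩, by simp only [hscale]; nlinarith [sq_nonneg a]⟩
  rw [hKe] at hmem
  exact hmem

/-- A path with positive semi-definite derivative is monotone for the Loewner order. -/
theorem le_of_deriv_nonneg {a b : ℝ} (hab : a ≤ b) {Y Y' : ℝ → Matrix (Fin r) (Fin r) ℝ}
    (hsymm : ∀ s ∈ Icc a b, (Y s).IsSymm)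
    (hY : ∀ s ∈ Icc a b, HasDerivWithinAt Y (Y' s) (Icc a b) s)
    (h : ∀ s ∈ Icc a b, (Y' s).PosSemidef) : Y a ≤ Y b := by
  rw [le_iff_quadratic (hsymm a (left_mem_Icc.2 hab)) (hsymm b (right_mem_Icc.2 hab))]
  intro x
  have hd : ∀ s ∈ Icc a b, HasDerivWithinAt (fun s => x ⬝ᵥ (Y s *ᵥ x)) (x ⬝ᵥ (Y' s *ᵥ x))
      (Icc a b) s := fun s hs => (quadEval x x).hasFDerivAt.comp_hasDerivWithinAt s (hY s hs)
  refine monotoneOn_of_hasDerivWithinAt_nonneg (f' := fun s => x ⬝ᵥ (Y' s *ᵥ x)) (convex_Icc a b)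
    (fun s hs => (hd s hs).continuousWithinAt) (fun s hs => ?_) (fun s hs => ?_)
    (left_mem_Icc.2 hab) (right_mem_Icc.2 hab) hab
  · exact (hd s (interior_subset hs)).mono interior_subset
  · exact (h s (interior_subset hs)).quadratic_nonneg x

/-- Closedness of the cone; it removes the small multiples of the identity that make the barrier
strict or a path invertible. -/
theorem posSemidef_of_forall_pos_add_smul_one {M : Matrix (Fin r) (Fin r) ℝ}
    (h : ∀ ε : ℝ, 0 < ε → (M + ε • (1 : Matrix (Fin r) (Fin r) ℝ)).PosSemidef) :
    M.PosSemidef := by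
  have ht : Tendsto (fun ε : ℝ => M + ε • (1 : Matrix (Fin r) (Fin r) ℝ)) (𝓝[>] 0) (𝓝 M) := by
    have : Continuous fun ε : ℝ => M + ε • (1 : Matrix (Fin r) (Fin r) ℝ) := by fun_prop
    simpa using (this.tendsto 0).mono_left nhdsWithin_le_nhds
  exact isClosed_posSemidef.mem_of_tendsto ht
    (by filter_upwards [self_mem_nhdsWithin] with ε hε using h ε hε)

/-! ### Comparison principle for the Riccati drift. -/

theorem isSymm_ricc {A R S Q : Matrix (Fin r) (Fin r) ℝ} (hR : R.IsSymm) (hS : S.IsSymm)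
    (hQ : Q.IsSymm) : (ricc A R S Q).IsSymm := by
  simp only [Matrix.IsSymm, ricc, transpose_add, transpose_sub, transpose_mul, transpose_transpose,
    hR.eq, hS.eq, hQ.eq, mul_assoc]
  abel

/-- The difference of two quadratic drifts is a Lyapunov operator applied to `Y - X`, with a
coefficient depending on `X + Y`. The doubling avoids halves. -/
theorem two_smul_ricc_sub {A R S X Y : Matrix (Fin r) (Fin r) ℝ} (hS : S.IsSymm) (hX : X.IsSymm)
    (hY : Y.IsSymm) :
    (ricc A R S Y - ricc A R S X) + (ricc A R S Y - ricc A R S X) =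
      (A + A - (X + Y) * S) * (Y - X) + (Y - X) * (A + A - (X + Y) * S)ᵀ := by
  simp only [ricc, transpose_add, transpose_sub, transpose_mul, hS.eq, hX.eq, hY.eq]
  noncomm_ring

theorem hasDerivAt_smul_exp_smul_one (ε k s : ℝ) :
    HasDerivAt (fun s => (ε * Real.exp (k * s)) • (1 : Matrix (Fin r) (Fin r) ℝ))
      ((k * (ε * Real.exp (k * s))) • (1 : Matrix (Fin r) (Fin r) ℝ)) s := by
  have h := (((hasDerivAt_id s).const_mul k).exp.const_mul ε).smul_const
    (1 : Matrix (Fin r) (Fin r) ℝ)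
  refine h.congr_deriv ?_
  simp only [id]
  congr 1
  ring

/-- **Comparison principle** for the matrix Riccati equation: subsolutions lie below
supersolutions. -/
theorem riccati_comparison {A R S : Matrix (Fin r) (Fin r) ℝ} (hS : S.IsSymm)
    {T : ℝ} {X Y X' Y' : ℝ → Matrix (Fin r) (Fin r) ℝ}
    (hXs : ∀ s ∈ Icc 0 T, (X s).IsSymm) (hYs : ∀ s ∈ Icc 0 T, (Y s).IsSymm)
    (hX : ∀ s ∈ Icc 0 T, HasDerivWithinAt X (X' s) (Icc 0 T) s)
    (hY : ∀ s ∈ Icc 0 T, HasDerivWithinAt Y (Y' s) (Icc 0 T) s)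
    (hX' : ∀ s ∈ Icc 0 T, X' s ≤ ricc A R S (X s))
    (hY' : ∀ s ∈ Icc 0 T, ricc A R S (Y s) ≤ Y' s)
    (h0 : X 0 ≤ Y 0) : ∀ s ∈ Icc 0 T, X s ≤ Y s := by
  have hXc : ContinuousOn X (Icc 0 T) := fun s hs => (hX s hs).continuousWithinAt
  have hYc : ContinuousOn Y (Icc 0 T) := fun s hs => (hY s hs).continuousWithinAt
  have hLc : ContinuousOn (fun s => A + A - (X s + Y s) * S) (Icc 0 T) := by fun_prop
  obtain ⟨C, hC⟩ := isCompact_Icc.exists_bound_of_continuousOn hLc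
  intro t ht
  rw [Matrix.le_iff]
  refine posSemidef_of_forall_pos_add_smul_one fun η hη => ?_
  -- On the kernel of the perturbed difference, `Y - X` acts as `-e`, so the Lyapunov term costs at
  -- most `C e |x|²`; the growth `k e |x|²` of the barrier beats it by `e |x|²`. The choice of `ε`
  -- makes the perturbation equal to `η` at time `t`.
  set k : ℝ := C + 1
  set ε : ℝ := η / Real.exp (k * t)
  have hε : 0 < ε := by positivity
  have key := posDef_of_barrier (T := T)
    (Y := fun s => Y s - X s + (ε * Real.exp (k * s)) • (1 : Matrix (Fin r) (Fin r) ℝ))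
    (Y' := fun s => Y' s - X' s + (k * (ε * Real.exp (k * s))) • (1 : Matrix (Fin r) (Fin r) ℝ))
    (fun s hs => ((hYs s hs).sub (hXs s hs)).add (isSymm_smul_one _))
    (fun s hs => ((hY s hs).sub (hX s hs)).add
      (hasDerivAt_smul_exp_smul_one ε k s).hasDerivWithinAt)
    (by
      refine PosDef.posSemidef_add (Matrix.le_iff.1 h0) ?_
      exact PosDef.one.smul (by positivity)) ?_ t ht
  · have e : ε * Real.exp (k * t) = η := div_mul_cancel₀ _ (Real.exp_pos _).ne'
    simp only [e] at key
    exact key.posSemidef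
  · intro s hs _ x hx hker
    set e : ℝ := ε * Real.exp (k * s)
    have he : 0 < e := by positivity
    have hxx : 0 < x ⬝ᵥ x := by
      have := (dotProduct_star_self_pos_iff (v := x)).2 hx
      simpa using this
    have hΔ : (Y s - X s) *ᵥ x = -(e • x) := by
      simp only [add_mulVec, smul_mulVec, one_mulVec] at hker
      exact eq_neg_of_add_eq_zero_left hker
    have h1 := (Matrix.le_iff.1 (hX' s hs)).quadratic_nonneg x
    have h2 := (Matrix.le_iff.1 (hY' s hs)).quadratic_nonneg x
    have h3 := congrArg (fun M => x ⬝ᵥ (M *ᵥ x))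
      (two_smul_ricc_sub (A := A) (R := R) hS (hXs s hs) (hYs s hs))
    have hΔs := (hYs s hs).sub (hXs s hs)
    set L := A + A - (X s + Y s) * S
    have h4 : x ⬝ᵥ ((L * (Y s - X s) + (Y s - X s) * Lᵀ) *ᵥ x) = -(2 * e * (x ⬝ᵥ (L *ᵥ x))) := by
      rw [add_mulVec, dotProduct_add, ← mulVec_mulVec, ← mulVec_mulVec, hΔ,
        hΔs.dotProduct_mulVec_comm, hΔ, neg_dotProduct, smul_dotProduct,
        dotProduct_mulVec_transpose, mulVec_neg, mulVec_smul, dotProduct_neg, dotProduct_smul]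
      simp only [smul_eq_mul]
      ring
    have h5 := (le_abs_self _).trans (abs_dotProduct_mulVec_le L x)
    have h6 : ‖L‖ * (x ⬝ᵥ x) ≤ C * (x ⬝ᵥ x) := mul_le_mul_of_nonneg_right (hC s hs) hxx.le
    simp only [h4] at h3
    simp only [add_mulVec, sub_mulVec, smul_mulVec, one_mulVec, dotProduct_add, dotProduct_sub,
      dotProduct_smul, smul_eq_mul] at h1 h2 h3 ⊢
    have h7 : e * (x ⬝ᵥ (L *ᵥ x)) ≤ e * (C * (x ⬝ᵥ x)) :=
      mul_le_mul_of_nonneg_left (h5.trans h6) he.le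
    have h8 : k * e * (x ⬝ᵥ x) = e * (C * (x ⬝ᵥ x)) + e * (x ⬝ᵥ x) := by simp only [k]; ring
    have h9 : 0 < e * (x ⬝ᵥ x) := by positivity
    linarith

/-! ### Matrix exponentials, Gramians and the upper Gramian bound. -/

theorem hasDerivAt_exp_affine (A : Matrix (Fin r) (Fin r) ℝ) (v s : ℝ) :
    HasDerivAt (fun s : ℝ => NormedSpace.exp (-((v - s) • A)))
      (A * NormedSpace.exp (-((v - s) • A))) s := by
  have h := (hasDerivAt_exp_smul_const' (𝕂 := ℝ) A (s - v)).scomp s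
    ((hasDerivAt_id s).sub_const v)
  simp only [one_smul] at h
  have e : ∀ u : ℝ, (u - v) • A = -((v - u) • A) := fun u => by rw [← neg_smul, neg_sub]
  have e2 : (fun u : ℝ => NormedSpace.exp (-((v - u) • A))) =
      (fun u => NormedSpace.exp (u • A)) ∘ fun x => id x - v := by
    funext u; simp only [Function.comp, id, e]
  rw [e2, ← e]
  exact h

theorem hasDerivAt_exp_neg_smul (A : Matrix (Fin r) (Fin r) ℝ) (s : ℝ) :
    HasDerivAt (fun s : ℝ => NormedSpace.exp (-(s • A)))
      (-(A * NormedSpace.exp (-(s • A)))) s := by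
  have h := hasDerivAt_exp_smul_const' (𝕂 := ℝ) (-A) s
  simpa using h

theorem hasDerivAt_exp_neg_smul' (A : Matrix (Fin r) (Fin r) ℝ) (s : ℝ) :
    HasDerivAt (fun s : ℝ => NormedSpace.exp (-(s • A)))
      (-(NormedSpace.exp (-(s • A)) * A)) s := by
  have h := hasDerivAt_exp_smul_const (𝕂 := ℝ) (-A) s
  simpa using h

theorem continuous_exp_neg_smul (A : Matrix (Fin r) (Fin r) ℝ) :
    Continuous fun s : ℝ => NormedSpace.exp (-(s • A)) :=
  continuous_iff_continuousAt.2 fun s => (hasDerivAt_exp_neg_smul A s).continuousAt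

theorem continuous_obsGramian_integrand (A S : Matrix (Fin r) (Fin r) ℝ) :
    Continuous fun s : ℝ => NormedSpace.exp (-(s • Aᵀ)) * S * NormedSpace.exp (-(s • A)) :=
  ((continuous_exp_neg_smul Aᵀ).mul continuous_const).mul (continuous_exp_neg_smul A)

theorem hasDerivAt_obsGramian (A S : Matrix (Fin r) (Fin r) ℝ) (s : ℝ) :
    HasDerivAt (obsGramian A S) (NormedSpace.exp (-(s • Aᵀ)) * S * NormedSpace.exp (-(s • A))) s :=
  intervalIntegral.integral_hasDerivAt_right
    ((continuous_obsGramian_integrand A S).intervalIntegrable _ _)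
    (continuous_obsGramian_integrand A S).aestronglyMeasurable.stronglyMeasurableAtFilter
    (continuous_obsGramian_integrand A S).continuousAt

theorem isSymm_intervalIntegral {f : ℝ → Matrix (Fin r) (Fin r) ℝ} (hf : Continuous f)
    (h : ∀ s, (f s).IsSymm) (a b : ℝ) : (∫ s in a..b, f s).IsSymm := by
  have := transposeL.intervalIntegral_comp_comm (hf.intervalIntegrable (μ := MeasureTheory.volume) a b)
  simp only [transposeL_apply, (h _).eq] at this
  exact this.symm

theorem isSymm_obsGramian (A : Matrix (Fin r) (Fin r) ℝ) {S : Matrix (Fin r) (Fin r) ℝ}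
    (hS : S.IsSymm) (t : ℝ) : (obsGramian A S t).IsSymm := by
  refine isSymm_intervalIntegral (continuous_obsGramian_integrand A S) (fun s => ?_) _ _
  simp [Matrix.IsSymm, ← exp_transpose, hS.eq, mul_assoc]

/-- The observability Gramian solves a Lyapunov equation. -/
theorem obsGramian_lyapunov (A S : Matrix (Fin r) (Fin r) ℝ) (t : ℝ) :
    NormedSpace.exp (-(t • Aᵀ)) * S * NormedSpace.exp (-(t • A)) =
      S - Aᵀ * obsGramian A S t - obsGramian A S t * A := by
  let f : ℝ → Matrix (Fin r) (Fin r) ℝ :=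
    fun s => NormedSpace.exp (-(s • Aᵀ)) * S * NormedSpace.exp (-(s • A))
  -- The integrand satisfies `f' = ℓ f`; integrating over `[0, t]` and pulling out `ℓ` gives the
  -- identity.
  let ℓ : Matrix (Fin r) (Fin r) ℝ →L[ℝ] Matrix (Fin r) (Fin r) ℝ :=
    -(ContinuousLinearMap.mul ℝ _ Aᵀ) - (ContinuousLinearMap.mul ℝ _).flip A
  have hf : ∀ s, HasDerivAt f (ℓ (f s)) s := fun s => by
    refine (((hasDerivAt_exp_neg_smul Aᵀ s).mul_const S).mul
      (hasDerivAt_exp_neg_smul' A s)).congr_deriv ?_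
    simp only [ℓ, f, _root_.sub_apply, _root_.neg_apply,
      ContinuousLinearMap.mul_apply', ContinuousLinearMap.flip_apply]
    noncomm_ring
  have hc : Continuous f := continuous_obsGramian_integrand A S
  have h1 := intervalIntegral.integral_eq_sub_of_hasDerivAt (fun s _ => hf s)
    ((ℓ.continuous.comp hc).intervalIntegrable 0 t)
  rw [ℓ.intervalIntegral_comp_comm (hc.intervalIntegrable 0 t)] at h1
  have h2 : f 0 = S := by simp [f]
  rw [h2] at h1
  have h3 : ∫ s in (0 : ℝ)..t, f s = obsGramian A S t := rfl
  rw [h3] at h1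
  have h4 : f t = S + ℓ (obsGramian A S t) := by rw [h1]; abel
  change f t = _
  rw [h4]
  simp only [ℓ, _root_.sub_apply, _root_.neg_apply,
      ContinuousLinearMap.mul_apply', ContinuousLinearMap.flip_apply]
  abel

/-- A subsolution of the Riccati equation on `[0, v]` is bounded at time `v` by the Gramian
estimate, whatever its initial condition. -/
theorem le_gramian_of_subsolution {A R S : Matrix (Fin r) (Fin r) ℝ} (hR : R.IsSymm)
    (hS : S.PosSemidef) {v : ℝ} (hv : 0 ≤ v) (hO : IsUnit (obsGramian A S v))
    {P P' : ℝ → Matrix (Fin r) (Fin r) ℝ} (hPs : ∀ s ∈ Icc 0 v, (P s).IsSymm)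
    (hP : ∀ s ∈ Icc 0 v, HasDerivWithinAt P (P' s) (Icc 0 v) s)
    (hP' : ∀ s ∈ Icc 0 v, P' s ≤ ricc A R S (P s)) :
    P v ≤ (obsGramian A S v)⁻¹ + ctrlObsGramian A R S v := by
  set O := obsGramian A S
  set N := (O v)⁻¹
  have hOs : ∀ s, (O s).IsSymm := isSymm_obsGramian A hS.isSymm
  have hN : Nᵀ = N := by rw [transpose_nonsing_inv, (hOs v).eq]
  have hOc : Continuous O :=
    continuous_iff_continuousAt.2 fun s => (hasDerivAt_obsGramian A S s).continuousAt
  have hO0 : O 0 = 0 := by simp [O, obsGramian]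
  have hdet : IsUnit (O v).det := (isUnit_iff_isUnit_det _).1 hO
  let E : ℝ → Matrix (Fin r) (Fin r) ℝ := fun s => NormedSpace.exp (-((v - s) • A))
  have hE : ∀ s, HasDerivAt E (A * E s) s := hasDerivAt_exp_affine A v
  have hEc : Continuous E := continuous_iff_continuousAt.2 fun s => (hE s).continuousAt
  have hEt : ∀ s, (E s)ᵀ = NormedSpace.exp (-((v - s) • Aᵀ)) := fun s => by
    simp [E, ← exp_transpose]
  -- The steering path is `Λ s = 𝒪_s e^{-(v-s)A} 𝒪_v⁻¹`, with `Λ 0 = 0` and `Λ v = 1`. It solves `Λ'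
  -- = S W - A' Λ`, with `W` as control.
  let W : ℝ → Matrix (Fin r) (Fin r) ℝ := fun s => E s * N
  let Λ : ℝ → Matrix (Fin r) (Fin r) ℝ := fun s => O s * W s
  have hW : ∀ s, HasDerivAt W (A * W s) s := fun s => by
    simpa [W, mul_assoc] using (hE s).mul_const N
  have hΛ : ∀ s, HasDerivAt Λ (S * W s - Aᵀ * Λ s) s := fun s => by
    refine ((hasDerivAt_obsGramian A S s).mul (hW s)).congr_deriv ?_
    rw [obsGramian_lyapunov]
    simp only [Λ, O]
    noncomm_ring
  have hΛt : ∀ s, HasDerivAt (fun s => (Λ s)ᵀ) ((S * W s - Aᵀ * Λ s)ᵀ) s := fun s =>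
    transposeL.hasFDerivAt.comp_hasDerivAt s (hΛ s)
  have hWc : Continuous W := hEc.mul continuous_const
  have hΛc : Continuous Λ := hOc.mul hWc
  let g : ℝ → Matrix (Fin r) (Fin r) ℝ := fun s => (Λ s)ᵀ * R * Λ s + (W s)ᵀ * S * W s
  have hgc : Continuous g :=
    ((((transposeL.continuous.comp hΛc).mul continuous_const).mul hΛc)).add
      (((transposeL.continuous.comp hWc).mul continuous_const).mul hWc)
  have hgs : ∀ s, (g s).IsSymm := fun s => by
    simp [Matrix.IsSymm, g, hR.eq, hS.isSymm.eq, mul_assoc]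
  let H : ℝ → Matrix (Fin r) (Fin r) ℝ := fun s => ∫ u in (0 : ℝ)..s, g u
  have hH : ∀ s, HasDerivAt H (g s) s := fun s =>
    intervalIntegral.integral_hasDerivAt_right (hgc.intervalIntegrable _ _)
      hgc.aestronglyMeasurable.stronglyMeasurableAtFilter hgc.continuousAt
  have hHs : ∀ s, (H s).IsSymm := fun s => isSymm_intervalIntegral hgc hgs _ _
  have key := le_of_deriv_nonneg hv (Y := fun s => H s - (Λ s)ᵀ * P s * Λ s)
    (Y' := fun s => g s - (((S * W s - Aᵀ * Λ s)ᵀ * P s + (Λ s)ᵀ * P' s) * Λ s +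
      (Λ s)ᵀ * P s * (S * W s - Aᵀ * Λ s)))
    (fun s hs => (hHs s).sub (by simp [Matrix.IsSymm, (hPs s hs).eq, mul_assoc]))
    (fun s hs => (hH s).hasDerivWithinAt.sub
      (((hΛt s).hasDerivWithinAt.mul (hP s hs)).mul (hΛ s).hasDerivWithinAt)) ?_
  · have hH0 : H 0 = 0 := by simp [H]
    have hΛ0 : Λ 0 = 0 := by simp [Λ, hO0]
    have hΛv : Λ v = 1 := by
      simp [Λ, W, E, N, Matrix.mul_nonsing_inv _ hdet]
    simp only [hH0, hΛ0, hΛv, transpose_zero, transpose_one, zero_mul, mul_zero, sub_zero, one_mul,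
      mul_one, sub_nonneg] at key
    refine key.trans (le_of_eq ?_)
    let f : ℝ → Matrix (Fin r) (Fin r) ℝ := fun s => NormedSpace.exp (-((v - s) • Aᵀ)) * O s * R *
      O s * NormedSpace.exp (-((v - s) • A))
    -- The `W' S W` part of the cost is the observability integrand read backwards in time, so it
    -- integrates to `𝒪_v⁻¹ 𝒪_v 𝒪_v⁻¹ = 𝒪_v⁻¹`.
    let f₂ : ℝ → Matrix (Fin r) (Fin r) ℝ :=
      fun s => NormedSpace.exp (-(s • Aᵀ)) * S * NormedSpace.exp (-(s • A))
    have hf₂c : Continuous f₂ := continuous_obsGramian_integrand A S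
    let c := ContinuousLinearMap.mulLeftRight ℝ (Matrix (Fin r) (Fin r) ℝ) N N
    have hg : ∀ s, g s = c (f s + f₂ (v - s)) := fun s => by
      simp only [g, W, Λ, c, f, f₂, transpose_mul, hEt, hN, (hOs s).eq,
        ContinuousLinearMap.mulLeftRight_apply]
      simp only [E]
      noncomm_ring
    have hfc : Continuous f := by
      have : f = fun s => (E s)ᵀ * O s * R * O s * E s := by funext s; simp only [hEt]; rfl
      rw [this]
      exact ((((transposeL.continuous.comp hEc).mul hOc).mul continuous_const).mul hOc).mul hEc
    have hf₂c' : Continuous fun s => f₂ (v - s) := hf₂c.comp (continuous_const.sub continuous_id)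
    have e1 : H v = c (∫ s in (0 : ℝ)..v, (f s + f₂ (v - s))) := by
      refine Eq.trans ?_ (c.intervalIntegral_comp_comm ((hfc.add hf₂c').intervalIntegrable 0 v))
      exact intervalIntegral.integral_congr fun s _ => hg s
    rw [e1, intervalIntegral.integral_add (hfc.intervalIntegrable 0 v)
      (hf₂c'.intervalIntegrable 0 v), intervalIntegral.integral_comp_sub_left f₂ v, sub_self,
      sub_zero, map_add, add_comm]
    have e2 : ∫ s in (0 : ℝ)..v, f₂ s = O v := rfl
    rw [e2]
    simp only [c, ContinuousLinearMap.mulLeftRight_apply]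
    congr 1
    simp [N, Matrix.nonsing_inv_mul _ hdet]
  · intro s hs
    have h1 := (Matrix.le_iff.1 (hP' s hs)).transpose_mul_mul (Λ s)
    -- The linear terms in `A` cancel along `Λ`; what remains is the square of `W - P Λ` weighted by
    -- `S`, plus the defect of the subsolution.
    have h2 := hS.transpose_mul_mul (W s - P s * Λ s)
    convert! h1.add h2 using 1
    simp only [g, ricc, transpose_sub, transpose_mul, transpose_transpose, (hPs s hs).eq,
      hS.isSymm.eq]
    noncomm_ring

/-! ### Duality, matrix inverses and the lower Gramian bound. -/

theorem obsGramian_neg_transpose (A R : Matrix (Fin r) (Fin r) ℝ) (t : ℝ) :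
    obsGramian (-Aᵀ) R t = ctrlGramian A R t := by
  simp [obsGramian, ctrlGramian]

/-- Passing from `P` to `P⁻¹` replaces `(A, R, S)` by `(-A', S, R)`, which exchanges the roles of
the Gramians. -/
theorem ctrlObsGramian_neg_transpose (A R S : Matrix (Fin r) (Fin r) ℝ) (t : ℝ) :
    ctrlObsGramian (-Aᵀ) S R t = obsCtrlGramian A R S t := by
  simp [ctrlObsGramian, obsCtrlGramian, obsGramian_neg_transpose]

/-- `Y - G⁻¹` is the sum of the congruences `(Y - G⁻¹) Y⁻¹ (Y - G⁻¹)` and `G⁻¹ (G - Y⁻¹) G⁻¹`. -/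
theorem inv_le_of_inv_le {G Y : Matrix (Fin r) (Fin r) ℝ} (hY : Y.PosDef) (h : Y⁻¹ ≤ G) :
    G⁻¹ ≤ Y := by
  have hG : G.PosDef := by
    have := hY.inv.add_posSemidef (Matrix.le_iff.1 h)
    rwa [add_sub_cancel] at this
  have hGs := hG.inv.posSemidef.isSymm
  have hYs := hY.posSemidef.isSymm
  have hYd := (isUnit_iff_isUnit_det _).1 hY.isUnit
  have hGd := (isUnit_iff_isUnit_det _).1 hG.isUnit
  have h1 := hY.inv.posSemidef.transpose_mul_mul (Y - G⁻¹)
  have h2 := (Matrix.le_iff.1 h).transpose_mul_mul G⁻¹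
  rw [Matrix.le_iff]
  convert! h1.add h2 using 1
  rw [transpose_sub, hYs.eq, hGs.eq]
  have a1 : (Y - G⁻¹) * Y⁻¹ * (Y - G⁻¹) = Y - G⁻¹ - G⁻¹ + G⁻¹ * Y⁻¹ * G⁻¹ := by
    simp only [sub_mul, mul_sub, Matrix.mul_nonsing_inv _ hYd, one_mul, mul_assoc,
      Matrix.nonsing_inv_mul _ hYd, mul_one]
    abel
  have a2 : G⁻¹ * (G - Y⁻¹) * G⁻¹ = G⁻¹ - G⁻¹ * Y⁻¹ * G⁻¹ := by
    simp only [sub_mul, mul_sub, Matrix.nonsing_inv_mul _ hGd, one_mul]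
  rw [a1, a2]
  abel

theorem hasDerivWithinAt_matrix_inv {Y : ℝ → Matrix (Fin r) (Fin r) ℝ}
    {Y' : Matrix (Fin r) (Fin r) ℝ} {I : Set ℝ} {s : ℝ} (hY : HasDerivWithinAt Y Y' I s)
    (hu : IsUnit (Y s)) :
    HasDerivWithinAt (fun s => (Y s)⁻¹) (-((Y s)⁻¹ * Y' * (Y s)⁻¹)) I s := by
  have : CompleteSpace (Matrix (Fin r) (Fin r) ℝ) := FiniteDimensional.complete ℝ _
  obtain ⟨u, hu⟩ := hu
  have h := hasFDerivAt_ringInverse (𝕜 := ℝ) u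
  rw [hu] at h
  have h2 := h.comp_hasDerivWithinAt s hY
  have e : (fun s => (Y s)⁻¹) = Ring.inverse ∘ Y := by
    funext s; simp [nonsing_inv_eq_ringInverse]
  rw [e]
  refine h2.congr_deriv ?_
  have e2 : ((u⁻¹ : (Matrix (Fin r) (Fin r) ℝ)ˣ) : Matrix (Fin r) (Fin r) ℝ) = (Y s)⁻¹ := by
    rw [← hu, coe_units_inv]
  simp [e2]

/-- A positive semi-definite solution of the Riccati equation on `[0, v]` is bounded from below at
time `v` by the Gramian estimate, whatever its initial condition. -/
theorem gramian_le_of_solution {A R S : Matrix (Fin r) (Fin r) ℝ} (hR : R.PosSemidef)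
    (hS : S.PosSemidef) {v : ℝ} (hv : 0 ≤ v) (hC : IsUnit (ctrlGramian A R v))
    {P : ℝ → Matrix (Fin r) (Fin r) ℝ} (hPs : ∀ s ∈ Icc 0 v, (P s).PosSemidef)
    (hP : ∀ s ∈ Icc 0 v, HasDerivWithinAt P (ricc A R S (P s)) (Icc 0 v) s) :
    (obsCtrlGramian A R S v + (ctrlGramian A R v)⁻¹)⁻¹ ≤ P v := by
  have hPc : ContinuousOn P (Icc 0 v) := fun s hs => (hP s hs).continuousWithinAt
  have hLc : ContinuousOn (fun s => A + Aᵀ - S * P s - P s * S) (Icc 0 v) := by fun_prop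
  obtain ⟨k, hk⟩ := isCompact_Icc.exists_bound_of_continuousOn hLc
  rw [Matrix.le_iff]
  refine posSemidef_of_forall_pos_add_smul_one fun η hη => ?_
  -- `P` may be singular, so it is shifted to the invertible `Y = P + ε e^{ks} Id`. The rate `k`
  -- bounds the terms of the drift that are linear in the shift, which makes `Y` a supersolution and
  -- `Y⁻¹` a subsolution of the dual equation.
  set ε : ℝ := η / Real.exp (k * v)
  have hε : 0 < ε := by positivity
  let Y : ℝ → Matrix (Fin r) (Fin r) ℝ :=
    fun s => P s + (ε * Real.exp (k * s)) • (1 : Matrix (Fin r) (Fin r) ℝ)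
  let Y' : ℝ → Matrix (Fin r) (Fin r) ℝ :=
    fun s => ricc A R S (P s) + (k * (ε * Real.exp (k * s))) • (1 : Matrix (Fin r) (Fin r) ℝ)
  have hY : ∀ s ∈ Icc 0 v, HasDerivWithinAt Y (Y' s) (Icc 0 v) s := fun s hs =>
    (hP s hs).add (hasDerivAt_smul_exp_smul_one ε k s).hasDerivWithinAt
  have hYpos : ∀ s ∈ Icc 0 v, (Y s).PosDef := fun s hs =>
    PosDef.posSemidef_add (hPs s hs) (PosDef.one.smul (by positivity))
  have hYv : Y v = P v + η • (1 : Matrix (Fin r) (Fin r) ℝ) := by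
    simp only [Y, ε, div_mul_cancel₀ _ (Real.exp_pos _).ne']
  have hsuper : ∀ s ∈ Icc 0 v, (Y' s - ricc A R S (Y s)).PosSemidef := by
    intro s hs
    set e : ℝ := ε * Real.exp (k * s)
    have he : 0 < e := by positivity
    have hPt := (hPs s hs).isSymm.eq
    have hsym : (A + Aᵀ - S * P s - P s * S).IsSymm := by
      simp only [Matrix.IsSymm, transpose_sub, transpose_add, transpose_mul, transpose_transpose,
        hPt, hS.isSymm.eq]
      abel
    have h1 : (k • (1 : Matrix (Fin r) (Fin r) ℝ) - (A + Aᵀ - S * P s - P s * S)).PosSemidef := by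
      rw [← Matrix.le_iff, le_iff_quadratic hsym (isSymm_smul_one _)]
      intro x
      have h2 := (le_abs_self _).trans (abs_dotProduct_mulVec_le (A + Aᵀ - S * P s - P s * S) x)
      have h3 : 0 ≤ x ⬝ᵥ x := by simpa using dotProduct_star_self_nonneg x
      simpa [smul_mulVec] using h2.trans (mul_le_mul_of_nonneg_right (hk s hs) h3)
    convert! (h1.smul he.le).add (hS.smul (sq_nonneg e)) using 1
    simp only [Y', Y, ricc, mul_add, add_mul, mul_smul_comm, smul_mul_assoc, mul_one, one_mul,
      smul_sub, smul_add, smul_smul]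
    rw [mul_comm e k, pow_two]
    abel
  have key := le_gramian_of_subsolution (A := -Aᵀ) (R := S) (S := R) hS.isSymm hR hv
    (by rwa [obsGramian_neg_transpose]) (P := fun s => (Y s)⁻¹)
    (P' := fun s => -((Y s)⁻¹ * Y' s * (Y s)⁻¹))
    (fun s hs => (hYpos s hs).inv.posSemidef.isSymm)
    (fun s hs => hasDerivWithinAt_matrix_inv (hY s hs) (hYpos s hs).isUnit) ?_
  · rw [obsGramian_neg_transpose, ctrlObsGramian_neg_transpose, add_comm] at key
    have := Matrix.le_iff.1 (inv_le_of_inv_le (hYpos v (right_mem_Icc.2 hv)) key)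
    rw [hYv] at this
    convert! this using 1
    abel
  · intro s hs
    have hd := (isUnit_iff_isUnit_det _).1 (hYpos s hs).isUnit
    have hZs := (hYpos s hs).inv.posSemidef.isSymm
    rw [Matrix.le_iff]
    convert! (hsuper s hs).transpose_mul_mul (Y s)⁻¹ using 1
    have e1 : (Y s)⁻¹ * ricc A R S (Y s) * (Y s)⁻¹ =
        (Y s)⁻¹ * A + Aᵀ * (Y s)⁻¹ - S + (Y s)⁻¹ * R * (Y s)⁻¹ := by
      have i1 := Matrix.mul_nonsing_inv _ hd
      have i2 := Matrix.nonsing_inv_mul _ hd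
      simp only [ricc, mul_add, add_mul, mul_sub, sub_mul]
      rw [show (Y s)⁻¹ * (A * Y s) * (Y s)⁻¹ = (Y s)⁻¹ * A * (Y s * (Y s)⁻¹) by noncomm_ring,
        show (Y s)⁻¹ * (Y s * Aᵀ) * (Y s)⁻¹ = ((Y s)⁻¹ * Y s) * Aᵀ * (Y s)⁻¹ by noncomm_ring,
        show (Y s)⁻¹ * (Y s * S * Y s) * (Y s)⁻¹ =
          ((Y s)⁻¹ * Y s) * S * (Y s * (Y s)⁻¹) by noncomm_ring, i1, i2]
      simp only [mul_one, one_mul]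
    rw [hZs.eq, mul_sub, sub_mul, e1]
    simp only [ricc, transpose_neg, transpose_transpose]
    noncomm_ring

/-! ### Global flows on the positive semi-definite cone. -/

/-- A bounded, globally Lipschitz vector field has a solution on every time interval `[0, T]`. -/
theorem exists_solution_of_bounded_lipschitz {E : Type*} [NormedAddCommGroup E] [NormedSpace ℝ E]
    [CompleteSpace E] {f : E → E} {K : NNReal} (hf : LipschitzWith K f) {L : ℝ}
    (hL : ∀ x, ‖f x‖ ≤ L) (x₀ : E) {T : ℝ} (hT : 0 ≤ T) :
    ∃ α : ℝ → E, α 0 = x₀ ∧ ∀ t ∈ Icc 0 T, HasDerivWithinAt α (f (α t)) (Icc 0 T) t := by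
  have hL0 : 0 ≤ L := (norm_nonneg _).trans (hL x₀)
  -- Speed at most `L` keeps the solution in the ball of radius `L * T` up to time `T`.
  have h : IsPicardLindelof (fun _ => f) (⟨0, left_mem_Icc.2 hT⟩ : Icc (0 : ℝ) T) x₀
      ⟨L * T, by positivity⟩ 0 ⟨L, hL0⟩ K := by
    refine IsPicardLindelof.of_time_independent (fun x _ => hL x) hf.lipschitzOnWith ?_
    change L * max (T - 0) (0 - 0) ≤ L * T - 0
    simp [max_eq_left hT]
  exact h.exists_eq_forall_mem_Icc_hasDerivWithinAt₀

theorem HasDerivWithinAt.Ici_of_Icc {E : Type*} [NormedAddCommGroup E] [NormedSpace ℝ E]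
    {f : ℝ → E} {f' : E} {a b t : ℝ} (h : HasDerivWithinAt f f' (Icc a b) t) (ht : t ∈ Ico a b) :
    HasDerivWithinAt f f' (Ici t) t :=
  h.mono_of_mem_nhdsWithin (mem_of_superset (Icc_mem_nhdsGE ht.2) (Icc_subset_Icc_left ht.1))

/-- The positive semi-definite matrices of trace at most `M`. -/
def psdTraceLE (r : ℕ) (M : ℝ) : Set (Matrix (Fin r) (Fin r) ℝ) :=
  {Q | Q.PosSemidef ∧ Q.trace ≤ M}

theorem isCompact_psdTraceLE (M : ℝ) : IsCompact (psdTraceLE r M) := by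
  have : ProperSpace (Matrix (Fin r) (Fin r) ℝ) := FiniteDimensional.proper ℝ _
  refine Metric.isCompact_of_isClosed_isBounded ?_ ?_
  · exact isClosed_posSemidef.inter (isClosed_le traceL.continuous continuous_const)
  · obtain ⟨c, hc, h⟩ := norm_le_trace (r := r)
    refine isBounded_iff_forall_norm_le.2 ⟨c * M, fun Q hQ => (h Q hQ.1).trans ?_⟩
    exact mul_le_mul_of_nonneg_left hQ.2 hc

/-- Radial retraction of the positive semi-definite cone onto the matrices of trace at most `M`. -/
noncomputable def traceRetract (M : ℝ) (Q : Matrix (Fin r) (Fin r) ℝ) :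
    Matrix (Fin r) (Fin r) ℝ :=
  (max 1 (Q.trace / M))⁻¹ • Q

theorem traceRetract_of_mem {M : ℝ} (hM : 0 < M) {Q : Matrix (Fin r) (Fin r) ℝ}
    (hQ : Q.trace ≤ M) : traceRetract M Q = Q := by
  rw [traceRetract, max_eq_left ((div_le_one hM).2 hQ)]
  simp

theorem traceRetract_mem {M : ℝ} (hM : 0 < M) {Q : Matrix (Fin r) (Fin r) ℝ}
    (hQ : Q.PosSemidef) : traceRetract M Q ∈ psdTraceLE r M := by
  have h1 : 0 < max 1 (Q.trace / M) := lt_max_of_lt_left one_pos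
  refine ⟨hQ.smul (inv_nonneg.2 h1.le), ?_⟩
  rw [traceRetract, trace_smul, smul_eq_mul, inv_mul_le_iff₀ h1, mul_comm, ← div_le_iff₀' hM]
  exact le_max_right _ _

theorem trace_traceRetract_le (M : ℝ) {Q : Matrix (Fin r) (Fin r) ℝ} (hQ : Q.PosSemidef) :
    (traceRetract M Q).trace ≤ Q.trace := by
  rw [traceRetract, trace_smul, smul_eq_mul]
  exact mul_le_of_le_one_left hQ.trace_nonneg (inv_le_one_of_one_le₀ (le_max_left _ _))

/-- Changing the scaling factor multiplies an unbounded `P`, but `b⁻¹ ‖P‖ ≤ c * M` compensates. -/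
theorem exists_lipschitzOn_traceRetract {M : ℝ} (hM : 0 < M) :
    ∃ K : NNReal, LipschitzOnWith K (traceRetract (r := r) M) {Q | Q.PosSemidef} := by
  obtain ⟨c, hc, h⟩ := norm_le_trace (r := r)
  refine ⟨⟨1 + c * r, by positivity⟩, LipschitzOnWith.of_dist_le_mul fun Q hQ P hP => ?_⟩
  rw [dist_eq_norm, dist_eq_norm]
  change _ ≤ (1 + c * r) * _
  set a := max 1 (Q.trace / M)
  set b := max 1 (P.trace / M)
  have ha : 1 ≤ a := le_max_left _ _
  have hb : 1 ≤ b := le_max_left _ _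
  have ha0 : 0 < a := one_pos.trans_le ha
  have hb0 : 0 < b := one_pos.trans_le hb
  have e : traceRetract M Q - traceRetract M P = a⁻¹ • (Q - P) + (a⁻¹ * ((b - a) * b⁻¹)) • P := by
    have : a⁻¹ * ((b - a) * b⁻¹) = a⁻¹ - b⁻¹ := by field_simp
    rw [this, sub_smul, smul_sub]
    simp only [traceRetract, a, b]
    abel
  have hab : |b - a| ≤ r * ‖Q - P‖ / M := by
    refine (abs_max_sub_max_le_max _ _ _ _).trans ?_
    rw [sub_self, abs_zero, max_eq_right (abs_nonneg _), ← sub_div, abs_div, abs_of_pos hM,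
      ← trace_sub, ← norm_sub_rev P Q]
    gcongr
    exact abs_trace_le _
  have hP' : b⁻¹ * ‖P‖ ≤ c * M := by
    rw [inv_mul_le_iff₀ hb0]
    refine (h P hP).trans ?_
    have : P.trace ≤ b * M := (div_le_iff₀ hM).1 (le_max_right _ _)
    nlinarith
  have hai : a⁻¹ ≤ 1 := inv_le_one_of_one_le₀ ha
  rw [e]
  refine (norm_add_le _ _).trans ?_
  rw [norm_smul, norm_smul, norm_mul, norm_mul, Real.norm_of_nonneg (inv_nonneg.2 ha0.le),
    Real.norm_of_nonneg (inv_nonneg.2 hb0.le), Real.norm_eq_abs]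
  have h1 : a⁻¹ * ‖Q - P‖ ≤ ‖Q - P‖ := mul_le_of_le_one_left (norm_nonneg _) hai
  have h2 : |b - a| * (b⁻¹ * ‖P‖) ≤ r * ‖Q - P‖ / M * (c * M) := by gcongr
  have h3 : r * ‖Q - P‖ / M * (c * M) = c * r * ‖Q - P‖ := by field_simp
  have h4 : a⁻¹ * (|b - a| * (b⁻¹ * ‖P‖)) ≤ |b - a| * (b⁻¹ * ‖P‖) :=
    mul_le_of_le_one_left (by positivity) hai
  calc _ = a⁻¹ * ‖Q - P‖ + a⁻¹ * (|b - a| * (b⁻¹ * ‖P‖)) := by ring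
    _ ≤ ‖Q - P‖ + c * r * ‖Q - P‖ := by linarith
    _ = _ := by ring

/-- Conditions on a drift on the positive semi-definite matrices under which it has a global
flow: local Lipschitz continuity, strict inwardness at the boundary of the cone, and at most
linear growth of the trace. -/
structure IsInwardDrift (F : Matrix (Fin r) (Fin r) ℝ → Matrix (Fin r) (Fin r) ℝ) : Prop where
  lipschitz : LocallyLipschitzOn {Q : Matrix (Fin r) (Fin r) ℝ | Q.PosSemidef} F
  symm : ∀ Q : Matrix (Fin r) (Fin r) ℝ, Q.PosSemidef → (F Q).IsSymm
  inward : ∀ Q : Matrix (Fin r) (Fin r) ℝ, Q.PosSemidef → ∀ x : Fin r → ℝ, x ≠ 0 →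
    Q *ᵥ x = 0 → 0 < x ⬝ᵥ (F Q *ᵥ x)
  growth : ∃ K : ℝ, 0 ≤ K ∧ ∀ Q : Matrix (Fin r) (Fin r) ℝ, Q.PosSemidef →
    (F Q).trace ≤ K * (1 + Q.trace)

namespace IsInwardDrift

variable {F : Matrix (Fin r) (Fin r) ℝ → Matrix (Fin r) (Fin r) ℝ}

theorem exists_lipschitzOn (hF : IsInwardDrift F) (M : ℝ) :
    ∃ K : NNReal, LipschitzOnWith K F (psdTraceLE r M) :=
  (hF.lipschitz.mono fun _ hQ => hQ.1).exists_lipschitzOnWith_of_compact (isCompact_psdTraceLE M)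

theorem solution_unique (hF : IsInwardDrift F) {Q : Matrix (Fin r) (Fin r) ℝ} {T : ℝ}
    {P₁ P₂ : ℝ → Matrix (Fin r) (Fin r) ℝ} (h₁ : IsSolution F Q T P₁) (h₂ : IsSolution F Q T P₂) :
    EqOn P₁ P₂ (Icc 0 T) := by
  have c₁ : ContinuousOn P₁ (Icc 0 T) := fun s hs => (h₁.2 s hs).2.continuousWithinAt
  have c₂ : ContinuousOn P₂ (Icc 0 T) := fun s hs => (h₂.2 s hs).2.continuousWithinAt
  obtain ⟨M₁, hM₁⟩ := isCompact_Icc.exists_bound_of_continuousOn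
    (traceL.continuous.comp_continuousOn c₁)
  obtain ⟨M₂, hM₂⟩ := isCompact_Icc.exists_bound_of_continuousOn
    (traceL.continuous.comp_continuousOn c₂)
  obtain ⟨K, hK⟩ := hF.exists_lipschitzOn (max M₁ M₂)
  refine ODE_solution_unique_of_mem_Icc_right (v := fun _ => F) (s := fun _ => psdTraceLE r (max M₁ M₂))
    (fun _ _ => hK) c₁ (fun t ht => (h₁.2 t (Ico_subset_Icc_self ht)).2.Ici_of_Icc ht)
    (fun t ht => ?_) c₂ (fun t ht => (h₂.2 t (Ico_subset_Icc_self ht)).2.Ici_of_Icc ht)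
    (fun t ht => ?_) (h₁.1.trans h₂.1.symm)
  · have ht' := Ico_subset_Icc_self ht
    exact ⟨(h₁.2 t ht').1, ((le_abs_self _).trans (hM₁ t ht')).trans (le_max_left _ _)⟩
  · have ht' := Ico_subset_Icc_self ht
    exact ⟨(h₂.2 t ht').1, ((le_abs_self _).trans (hM₂ t ht')).trans (le_max_right _ _)⟩

theorem exists_solution (hF : IsInwardDrift F) {Q : Matrix (Fin r) (Fin r) ℝ} (hQ : Q.PosSemidef)
    {T : ℝ} (hT : 0 ≤ T) : ∃ P, IsSolution F Q T P := by
  have : CompleteSpace (Matrix (Fin r) (Fin r) ℝ) := FiniteDimensional.complete ℝ _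
  obtain ⟨K, hK, hgrow⟩ := hF.growth
  have hQt := hQ.trace_nonneg
  -- The Grönwall bound for the trace on `[0, T]`, so that the cut-off at `M` is never active.
  set M : ℝ := (1 + Q.trace) * Real.exp (K * T)
  have hM : 0 < M := by positivity
  obtain ⟨K₁, hK₁⟩ := hF.exists_lipschitzOn M
  obtain ⟨K₂, hK₂⟩ := exists_lipschitzOn_traceRetract (r := r) hM
  obtain ⟨K₃, hK₃⟩ := exists_lipschitz_symmPosPart (r := r)
  have hpp : ∀ X : Matrix (Fin r) (Fin r) ℝ, (symmPosPart X).PosSemidef := fun X =>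
    posSemidef_posPart _
  have hmem : ∀ X : Matrix (Fin r) (Fin r) ℝ,
      traceRetract M (symmPosPart X) ∈ psdTraceLE r M := fun X => traceRetract_mem hM (hpp X)
  let G : Matrix (Fin r) (Fin r) ℝ → Matrix (Fin r) (Fin r) ℝ :=
    fun X => F (traceRetract M (symmPosPart X))
  have hG : LipschitzWith (K₁ * (K₂ * K₃)) G := by
    rw [← lipschitzOnWith_univ]
    exact hK₁.comp (hK₂.comp hK₃.lipschitzOnWith fun X _ => hpp X) fun X _ => hmem X
  obtain ⟨L, hL⟩ := (isCompact_psdTraceLE M).exists_bound_of_continuousOn hK₁.continuousOn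
  obtain ⟨X, hX0, hX⟩ := exists_solution_of_bounded_lipschitz hG (fun X => hL _ (hmem X)) Q hT
  have hXc : ContinuousOn X (Icc 0 T) := fun s hs => (hX s hs).continuousWithinAt
  have hGs : ∀ X, (G X).IsSymm := fun X => hF.symm _ (hmem X).1
  have hXs : ∀ s ∈ Icc 0 T, (X s).IsSymm := by
    intro s hs
    have := constant_of_has_deriv_right_zero (f := fun s => X s - transposeL (X s))
      (hXc.sub (transposeL.continuous.comp_continuousOn hXc)) (fun t ht => by
        have h1 := (hX t (Ico_subset_Icc_self ht)).Ici_of_Icc ht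
        have h2 := h1.sub (transposeL.hasFDerivAt.comp_hasDerivWithinAt t h1)
        rwa [transposeL_apply, (hGs _).eq, sub_self] at h2) s hs
    simp only [transposeL_apply, hX0, hQ.isSymm.eq, sub_self] at this
    exact (sub_eq_zero.1 this).symm
  have hXpos : ∀ s ∈ Icc 0 T, (X s).PosSemidef := by
    intro t ht
    refine posSemidef_of_forall_pos_add_smul_one fun ε hε => ?_
    refine (posDef_of_barrier (Y := fun s => X s + ε • (1 : Matrix (Fin r) (Fin r) ℝ))
      (Y' := fun s => G (X s)) (fun s hs => (hXs s hs).add (isSymm_smul_one _))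
      (fun s hs => (hX s hs).add_const _) ?_ ?_ t ht).posSemidef
    · rw [hX0]
      exact PosDef.posSemidef_add hQ (PosDef.one.smul hε)
    · intro s hs _ x hx hker
      have hev : X s *ᵥ x = -(ε • x) := by
        rw [add_mulVec, smul_mulVec, one_mulVec] at hker
        exact eq_neg_of_add_eq_zero_left hker
      -- `x` is an eigenvector of `X s` for `-ε`, so the positive part and its rescaling both
      -- annihilate it.
      refine hF.inward _ (hmem (X s)).1 x hx ?_
      rw [traceRetract, smul_mulVec, symmPosPart_of_isSymm (hXs s hs),
        posPart_mulVec_eq_zero (hXs s hs) hε hev, smul_zero]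
  have hder : ∀ s ∈ Icc 0 T, HasDerivWithinAt (fun s => (1 + (X s).trace) * Real.exp (-K * s))
      ((G (X s)).trace * Real.exp (-K * s) +
        (1 + (X s).trace) * (Real.exp (-K * s) * -K)) (Icc 0 T) s := fun s hs => by
    have h1 := (traceL.hasFDerivAt.comp_hasDerivWithinAt s (hX s hs)).const_add 1
    have h2 := (((hasDerivAt_id s).const_mul (-K)).exp).hasDerivWithinAt (s := Icc 0 T)
    have h3 := h1.mul h2
    simpa using! h3
  have hanti : AntitoneOn (fun s => (1 + (X s).trace) * Real.exp (-K * s)) (Icc 0 T) := by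
    refine antitoneOn_of_hasDerivWithinAt_nonpos (convex_Icc 0 T)
      (fun s hs => (hder s hs).continuousWithinAt)
      (fun s hs => (hder s (interior_subset hs)).mono interior_subset) fun s hs => ?_
    have hs' := interior_subset hs
    have h1 := hgrow _ (hmem (X s)).1
    -- The retraction only lowers the trace, so the growth bound holds with the trace of `X s`
    -- itself.
    have h2 := trace_traceRetract_le M (hpp (X s))
    rw [symmPosPart_of_posSemidef (hXpos s hs')] at h1 h2
    have h3 : (G (X s)).trace ≤ K * (1 + (X s).trace) := by
      simp only [G, symmPosPart_of_posSemidef (hXpos s hs')]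
      refine h1.trans ?_
      gcongr
    nlinarith [Real.exp_pos (-K * s)]
  have htr : ∀ s ∈ Icc 0 T, (X s).trace ≤ M := by
    intro s hs
    have h1 := hanti (left_mem_Icc.2 hT) hs hs.1
    simp only [hX0, mul_zero, Real.exp_zero, mul_one, neg_mul, Real.exp_neg] at h1
    rw [← div_eq_mul_inv, div_le_iff₀ (Real.exp_pos _)] at h1
    have h2 : Real.exp (K * s) ≤ Real.exp (K * T) :=
      Real.exp_le_exp.2 (mul_le_mul_of_nonneg_left hs.2 hK)
    have h3 : (1 + Q.trace) * Real.exp (K * s) ≤ M := by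
      simp only [M]; gcongr
    linarith
  refine ⟨X, hX0, fun s hs => ⟨hXpos s hs, ?_⟩⟩
  have := hX s hs
  simpa only [G, symmPosPart_of_posSemidef (hXpos s hs), traceRetract_of_mem hM (htr s hs)] using this

theorem exists_isFlow (hF : IsInwardDrift F) :
    ∃ φ : ℝ → Matrix (Fin r) (Fin r) ℝ → Matrix (Fin r) (Fin r) ℝ, IsFlow F φ := by
  have h : ∀ (Q : Matrix (Fin r) (Fin r) ℝ) (T : ℝ), ∃ P : ℝ → Matrix (Fin r) (Fin r) ℝ,
      Q.PosSemidef → 0 ≤ T → IsSolution F Q T P := fun Q T => by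
    by_cases hQ : Q.PosSemidef
    · by_cases hT : 0 ≤ T
      · obtain ⟨P, hP⟩ := hF.exists_solution hQ hT
        exact ⟨P, fun _ _ => hP⟩
      · exact ⟨0, fun _ h => absurd h hT⟩
    · exact ⟨0, fun h => absurd h hQ⟩
  choose P hP using h
  -- At time `t` the solution with horizon `t` is used; uniqueness makes it agree with that of any
  -- longer horizon.
  refine ⟨fun t Q => P Q t t, fun Q hQ T hT => ?_⟩
  have hPT := hP Q T hQ hT
  have heq : EqOn (fun t => P Q t t) (P Q T) (Icc 0 T) := fun t ht => by
    have hres : IsSolution F Q t (P Q T) := ⟨hPT.1, fun s hs =>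
      have hs' : s ∈ Icc 0 T := ⟨hs.1, hs.2.trans ht.2⟩
      ⟨(hPT.2 s hs').1, (hPT.2 s hs').2.mono (Icc_subset_Icc_right ht.2)⟩⟩
    exact hF.solution_unique (hP Q t hQ ht.1) hres (right_mem_Icc.2 ht.1)
  have hsol : IsSolution F Q T (fun t => P Q t t) := by
    refine ⟨(heq (left_mem_Icc.2 hT)).trans hPT.1, fun s hs => ?_⟩
    have e : P Q s s = P Q T s := heq hs
    simp only [e]
    exact ⟨(hPT.2 s hs).1, (hPT.2 s hs).2.congr heq e⟩
  exact ⟨hsol, fun P' hP' => hF.solution_unique hP' hsol⟩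

end IsInwardDrift

/-! ### Riccati drifts are inward. -/

theorem trace_le_trace_of_le {M N : Matrix (Fin r) (Fin r) ℝ} (h : M ≤ N) : M.trace ≤ N.trace := by
  have := (Matrix.le_iff.1 h).trace_nonneg
  rwa [trace_sub, sub_nonneg] at this

theorem exists_trace_ricc_le (A R : Matrix (Fin r) (Fin r) ℝ) {S : Matrix (Fin r) (Fin r) ℝ}
    (hS : S.PosSemidef) : ∃ K : ℝ, 0 ≤ K ∧ ∀ Q : Matrix (Fin r) (Fin r) ℝ, Q.PosSemidef →
      (ricc A R S Q).trace ≤ K * (1 + Q.trace) := by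
  obtain ⟨c, hc, h⟩ := norm_le_trace (r := r)
  refine ⟨2 * (r * (‖A‖ * c)) + |R.trace|, by positivity, fun Q hQ => ?_⟩
  have h0 := hQ.trace_nonneg
  have h1 : (A * Q).trace ≤ r * (‖A‖ * (c * Q.trace)) := by
    refine (le_abs_self _).trans ((abs_trace_le _).trans ?_)
    gcongr
    refine (l2_opNorm_mul _ _).trans ?_
    gcongr
    exact h Q hQ
  have h2 : (Q * Aᵀ).trace = (A * Q).trace := by
    rw [← trace_transpose, transpose_mul, transpose_transpose, hQ.isSymm.eq]
  have h3 : 0 ≤ (Q * S * Q).trace := by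
    have := (hS.transpose_mul_mul Q).trace_nonneg
    rwa [hQ.isSymm.eq] at this
  have h4 := le_abs_self R.trace
  have h5 : 0 ≤ |R.trace| * Q.trace := by positivity
  have h6 : (0 : ℝ) ≤ r * (‖A‖ * c) := by positivity
  rw [ricc, trace_add, trace_sub, trace_add, h2]
  nlinarith

/-- On a kernel vector of `Q` every term except `R` vanishes. -/
theorem isInwardDrift_ricc (A : Matrix (Fin r) (Fin r) ℝ) {R S : Matrix (Fin r) (Fin r) ℝ}
    (hR : R.PosDef) (hS : S.PosSemidef) : IsInwardDrift (ricc A R S) where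
  lipschitz := by
    have : ContDiff ℝ 1 (ricc A R S) := by
      unfold ricc
      fun_prop
    exact this.locallyLipschitz.locallyLipschitzOn
  symm Q hQ := isSymm_ricc hR.posSemidef.isSymm hS.isSymm hQ.isSymm
  inward Q hQ x hx hker := by
    have h := (posDef_iff_quadratic.1 hR).2 x hx
    have e : x ⬝ᵥ (ricc A R S Q *ᵥ x) = x ⬝ᵥ (R *ᵥ x) := by
      have h1 : x ⬝ᵥ ((Q * Aᵀ) *ᵥ x) = 0 := by
        rw [← mulVec_mulVec, hQ.isSymm.dotProduct_mulVec_comm, hker, zero_dotProduct]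
      simp only [ricc, add_mulVec, sub_mulVec, dotProduct_add, dotProduct_sub, h1]
      simp only [← mulVec_mulVec, hker, mulVec_zero, dotProduct_zero]
      ring
    rwa [e]
  growth := exists_trace_ricc_le A R hS

/-! ### The perturbed drift between two Riccati drifts. -/

theorem posSemidef_obsMatrix {r' : ℕ} (C : Matrix (Fin r') (Fin r) ℝ)
    {Sig : Matrix (Fin r') (Fin r') ℝ} (hSig : Sig.PosDef) : (obsMatrix C Sig).PosSemidef := by
  have := hSig.inv.posSemidef.conjTranspose_mul_mul_same C
  rwa [conjTranspose_eq_transpose_of_trivial] at this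

theorem riccPert_sub_ricc {A R S : Matrix (Fin r) (Fin r) ℝ} (hS : S.IsSymm)
    {π : Matrix (Fin r) (Fin r) ℝ → Matrix (Fin r) (Fin r) ℝ} {Q : Matrix (Fin r) (Fin r) ℝ}
    (hQ : Q.IsSymm) (hπ : (π Q).IsSymm) :
    riccPert A R S π Q - ricc A R S Q = (π Q - Q)ᵀ * S * (π Q - Q) := by
  simp only [riccPert, ricc, transpose_sub, transpose_mul, hS.eq, hQ.eq, hπ.eq]
  noncomm_ring

theorem ricc_le_riccPert {A R S : Matrix (Fin r) (Fin r) ℝ} (hS : S.PosSemidef)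
    {π : Matrix (Fin r) (Fin r) ℝ → Matrix (Fin r) (Fin r) ℝ} {Q : Matrix (Fin r) (Fin r) ℝ}
    (hQ : Q.PosSemidef) (hπ : (π Q).PosSemidef) : ricc A R S Q ≤ riccPert A R S π Q := by
  rw [Matrix.le_iff, riccPert_sub_ricc hS.isSymm hQ.isSymm hπ.isSymm]
  exact hS.transpose_mul_mul _

namespace QuadraticPerturbation

variable {A R S B₀ B₁ B₂ : Matrix (Fin r) (Fin r) ℝ}
  {π Rem : Matrix (Fin r) (Fin r) ℝ → Matrix (Fin r) (Fin r) ℝ}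

theorem posSemidef_remBound_sub (h : QuadraticPerturbation A R S π B₀ B₁ B₂ Rem)
    {Q : Matrix (Fin r) (Fin r) ℝ} (hQ : Q.PosSemidef) :
    (remBound Rem • (1 : Matrix (Fin r) (Fin r) ℝ) - Rem Q).PosSemidef := by
  have h1 : ‖Rem Q‖ ≤ remBound Rem := le_csSup h.rem_bdd ⟨Q, hQ, rfl⟩
  have h2 := Matrix.le_iff.1 (le_norm_smul_one (h.rem_symm Q hQ))
  have h3 := (PosSemidef.one (n := Fin r) (R := ℝ)).smul (sub_nonneg.2 h1)
  convert! h2.add h3 using 1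
  rw [sub_smul]
  abel

theorem riccPert_le (h : QuadraticPerturbation A R S π B₀ B₁ B₂ Rem)
    {Q : Matrix (Fin r) (Fin r) ℝ} (hQ : Q.PosSemidef) :
    riccPert A R S π Q ≤ ricc (A + B₁) (R + B₀ + remBound Rem • (1 : Matrix (Fin r) (Fin r) ℝ))
      (S - B₂) Q := by
  rw [Matrix.le_iff]
  -- The gap between the two drifts is exactly `ϖ Id - ℛ(Q)`.
  convert! h.posSemidef_remBound_sub hQ using 1
  rw [eq_add_of_sub_eq (h.eq Q hQ)]
  simp only [ricc, transpose_add]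
  noncomm_ring

/-- At `Q = 0` the square reads `B₀ + ℛ(0) ≥ 0`, so `R_π ≥ R`. This supplies the inwardness of
`Ricc_π`. -/
theorem posDef_noise (h : QuadraticPerturbation A R S π B₀ B₁ B₂ Rem) (hR : R.PosDef)
    (hS : S.PosSemidef) (hπ : (π 0).PosSemidef) :
    (R + B₀ + remBound Rem • (1 : Matrix (Fin r) (Fin r) ℝ)).PosDef := by
  have hz : (0 : Matrix (Fin r) (Fin r) ℝ).PosSemidef := PosSemidef.zero
  have h1 := Matrix.le_iff.1 (ricc_le_riccPert (A := A) (R := R) hS hz hπ)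
  rw [h.eq 0 hz] at h1
  convert! (hR.add_posSemidef h1).add_posSemidef (h.posSemidef_remBound_sub hz) using 1
  simp
  abel

/-- Inwardness is inherited from the lower drift `Ricc`, linear trace growth from the upper drift
`Ricc_π`. -/
theorem isInwardDrift_riccPert (h : QuadraticPerturbation A R S π B₀ B₁ B₂ Rem) (hR : R.PosDef)
    (hS : S.PosSemidef)
    (hπ : ∀ Q : Matrix (Fin r) (Fin r) ℝ, Q.PosSemidef → (π Q).PosSemidef)
    (hL : LocallyLipschitzOn {Q : Matrix (Fin r) (Fin r) ℝ | Q.PosSemidef} (riccPert A R S π)) :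
    IsInwardDrift (riccPert A R S π) where
  lipschitz := hL
  symm Q hQ := by
    have h1 := (Matrix.le_iff.1 (ricc_le_riccPert (A := A) (R := R) hS hQ (hπ Q hQ))).isSymm
    have h2 := h1.add (isSymm_ricc (A := A) hR.posSemidef.isSymm hS.isSymm hQ.isSymm)
    rwa [sub_add_cancel] at h2
  inward Q hQ x hx hker := by
    have h1 := (isInwardDrift_ricc A hR hS).inward Q hQ x hx hker
    have h2 := (Matrix.le_iff.1
      (ricc_le_riccPert (A := A) (R := R) hS hQ (hπ Q hQ))).quadratic_nonneg x
    rw [sub_mulVec, dotProduct_sub] at h2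
    linarith
  growth := by
    obtain ⟨K, hK, hg⟩ := exists_trace_ricc_le (A + B₁)
      (R + B₀ + remBound Rem • (1 : Matrix (Fin r) (Fin r) ℝ)) (Matrix.le_iff.1 h.le)
    exact ⟨K, hK, fun Q hQ => (trace_le_trace_of_le (h.riccPert_le hQ)).trans (hg Q hQ)⟩

end QuadraticPerturbation

/-! ### Time shift and conclusion. -/

theorem IsSolution.shift {F : Matrix (Fin r) (Fin r) ℝ → Matrix (Fin r) (Fin r) ℝ}
    {Q : Matrix (Fin r) (Fin r) ℝ} {t v : ℝ} {P : ℝ → Matrix (Fin r) (Fin r) ℝ}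
    (h : IsSolution F Q t P) (hvt : v ≤ t) :
    IsSolution F (P (t - v)) v (fun s => P (t - v + s)) := by
  have hmaps : MapsTo (fun s => t - v + s) (Icc 0 v) (Icc 0 t) := fun s hs =>
    ⟨by linarith [hs.1], by linarith [hs.2]⟩
  refine ⟨by simp, fun s hs => ⟨(h.2 _ (hmaps hs)).1, ?_⟩⟩
  have := (h.2 _ (hmaps hs)).2.scomp s
    (((hasDerivAt_id s).const_add (t - v)).hasDerivWithinAt (s := Icc 0 v)) hmaps
  simpa using! this

theorem isUnit_of_smul_one_le {M : Matrix (Fin r) (Fin r) ℝ} {a : ℝ} (ha : 0 < a)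
    (h : a • (1 : Matrix (Fin r) (Fin r) ℝ) ≤ M) : IsUnit M := by
  have := ((PosDef.one (n := Fin r) (R := ℝ)).smul ha).add_posSemidef (Matrix.le_iff.1 h)
  rw [add_sub_cancel] at this
  exact this.isUnit

end RiccatiFlows

open Matrix Set in
theorem theorem2p4 {r r' : ℕ}
    (A R : Matrix (Fin r) (Fin r) ℝ) (C : Matrix (Fin r') (Fin r) ℝ)
    (Sig : Matrix (Fin r') (Fin r') ℝ) (hR : R.PosDef) (hSig : Sig.PosDef)
    (S : Matrix (Fin r) (Fin r) ℝ) (hS : S = obsMatrix C Sig)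
    (v : ℝ) (hv : GramianCondition A R S v)
    (π : Matrix (Fin r) (Fin r) ℝ → Matrix (Fin r) (Fin r) ℝ)
    (hπ : ∀ Q : Matrix (Fin r) (Fin r) ℝ, Q.PosSemidef → (π Q).PosSemidef)
    (B₀ B₁ B₂ : Matrix (Fin r) (Fin r) ℝ)
    (Rem : Matrix (Fin r) (Fin r) ℝ → Matrix (Fin r) (Fin r) ℝ)
    (h0 : QuadraticPerturbation A R S π B₀ B₁ B₂ Rem)
    (Aπ Rπ Sπ : Matrix (Fin r) (Fin r) ℝ)
    (hAπ : Aπ = A + B₁)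
    (hRπ : Rπ = R + B₀ + remBound Rem • (1 : Matrix (Fin r) (Fin r) ℝ))
    (hSπ : Sπ = S - B₂)
    (νπ : ℝ) (h1 : GramianCondition Aπ Rπ Sπ νπ) :
    ∃ φ φπ : ℝ → Matrix (Fin r) (Fin r) ℝ → Matrix (Fin r) (Fin r) ℝ,
      IsFlow (ricc A R S) φ ∧ IsFlow (ricc Aπ Rπ Sπ) φπ ∧
      -- the ordering, for every solution of the perturbed equation that exists up to time `t`
      (∀ t : ℝ, max v νπ ≤ t → ∀ Q : Matrix (Fin r) (Fin r) ℝ, Q.PosSemidef →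
        ∀ P : ℝ → Matrix (Fin r) (Fin r) ℝ, IsSolution (riccPert A R S π) Q t P →
          (obsCtrlGramian A R S v + (ctrlGramian A R v)⁻¹)⁻¹ ≤ φ t Q ∧
          φ t Q ≤ P t ∧
          P t ≤ φπ t Q ∧
          φπ t Q ≤ (obsGramian Aπ Sπ νπ)⁻¹ + ctrlObsGramian Aπ Rπ Sπ νπ) ∧
      -- for a locally Lipschitz perturbed drift the perturbed flow exists globally
      (LocallyLipschitzOn {Q : Matrix (Fin r) (Fin r) ℝ | Q.PosSemidef} (riccPert A R S π) →
        ∃ φ' : ℝ → Matrix (Fin r) (Fin r) ℝ → Matrix (Fin r) (Fin r) ℝ,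
          IsFlow (riccPert A R S π) φ') := by
  have hSpos : S.PosSemidef := hS ▸ posSemidef_obsMatrix C hSig
  have hSπpos : Sπ.PosSemidef := hSπ ▸ Matrix.le_iff.1 h0.le
  have hRπpos : Rπ.PosDef := hRπ ▸ h0.posDef_noise hR hSpos (hπ 0 PosSemidef.zero)
  have hupper : ∀ Q : Matrix (Fin r) (Fin r) ℝ, Q.PosSemidef →
      riccPert A R S π Q ≤ ricc Aπ Rπ Sπ Q := fun Q hQ => by
    rw [hAπ, hRπ, hSπ]
    exact h0.riccPert_le hQ
  obtain ⟨φ, hφ⟩ := (isInwardDrift_ricc A hR hSpos).exists_isFlow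
  obtain ⟨φπ, hφπ⟩ := (isInwardDrift_ricc Aπ hRπpos hSπpos).exists_isFlow
  refine ⟨φ, φπ, hφ, hφπ, fun t ht Q hQ P hP => ?_,
    fun hL => (h0.isInwardDrift_riccPert hR hSpos hπ hL).exists_isFlow⟩
  obtain ⟨hv0, ⟨a, _, ha, _, hC, _⟩, _⟩ := hv
  obtain ⟨hν0, _, ⟨b, _, hb, _, hO, _⟩⟩ := h1
  have hvt : v ≤ t := (le_max_left _ _).trans ht
  have hνt : νπ ≤ t := (le_max_right _ _).trans ht
  have ht0 : 0 ≤ t := hv0.le.trans hvt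
  have htm : t ∈ Icc 0 t := right_mem_Icc.2 ht0
  have sφ := (hφ Q hQ t ht0).1
  have sφπ := (hφπ Q hQ t ht0).1
  refine ⟨?_, ?_, ?_, ?_⟩
  -- The Gramian bound is applied on the window `[t - v, t]`, started from `φ_{t-v}(Q)`.
  · have hs := sφ.shift hvt
    have := gramian_le_of_solution hR.posSemidef hSpos hv0.le (isUnit_of_smul_one_le ha hC)
      (fun s hs' => (hs.2 s hs').1) (fun s hs' => (hs.2 s hs').2)
    simpa using this
  · exact riccati_comparison hSpos.isSymm (fun s hs => (sφ.2 s hs).1.isSymm)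
      (fun s hs => (hP.2 s hs).1.isSymm) (fun s hs => (sφ.2 s hs).2) (fun s hs => (hP.2 s hs).2)
      (fun s hs => le_rfl) (fun s hs => ricc_le_riccPert hSpos (hP.2 s hs).1 (hπ _ (hP.2 s hs).1))
      (sφ.1.trans hP.1.symm).le t htm
  · exact riccati_comparison hSπpos.isSymm (fun s hs => (hP.2 s hs).1.isSymm)
      (fun s hs => (sφπ.2 s hs).1.isSymm) (fun s hs => (hP.2 s hs).2) (fun s hs => (sφπ.2 s hs).2)
      (fun s hs => hupper _ (hP.2 s hs).1) (fun s hs => le_rfl)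
      (hP.1.trans sφπ.1.symm).le t htm
  · have hs := sφπ.shift hνt
    have := le_gramian_of_subsolution hRπpos.posSemidef.isSymm hSπpos hν0.le
      (isUnit_of_smul_one_le hb hO) (fun s hs' => (hs.2 s hs').1.isSymm)
      (fun s hs' => (hs.2 s hs').2) (fun s hs' => le_rfl)
    simpa using this
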